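/- Let $n\ge 0$ and $d\ge 1$ be integers and let $p\in(0,1)$ be such that $pn$ is an integer. Let $D_p$ be the uniform distribution on all assignments $x\in\{\pm1\}^n$ with $\sum_{i=1}^n x_i=(1-2p)n$, and let $U_p$ be the product distribution on $\{\pm1\}^n$ in which each bit equals $-1$ with probability $p$ and $1$ with probability $1-p$. For $x\in\{\pm 1\}^n$ let $\phi_i=\sqrt{\frac{p}{1-p}}$ if $x_i=1$ and $\phi_i=-\sqrt{\frac{1-p}{p}}$ if $x_i=-1$, and write $\|g\|_2=\mathbb{E}_{U_p}[g^2]^{1/2}$ for $g:\{\pm1\}^n\to\mathbb{R}$. Put $$C=256\left(\Big(\frac{1-p}{p}\Big)^2+\Big(\frac{p}{1-p}\Big)^2\right)^2 .$$ Then for every real multilinear polynomial $f$ in $n$ variables of degree at most $d$: 1. $\mathbb{E}_{D_p}[f(\phi_1,\dots,\phi_n)^4]\le 3\, d^{3/2}\, C^d\, \|f(\phi_1,\dots,\phi_n)\|_2^4$; 2. $\mathbb{E}_{D_p}[f(\phi_1,\dots,\phi_n)^4]\le 12\, d^{3/2}\, C^d\, \mathbb{E}_{D_p}[f(\phi_1,\dots,\phi_n)^2]^2$;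 3. $\mathbb{E}_{D_p}[f(x_1,\dots,x_n)^4]\le 12\, d^{3/2}\, C^d\, \mathbb{E}_{D_p}[f(x_1,\dots,x_n)^2]^2$. -/

import Mathlib

open scoped BigOperators

noncomputable section

namespace GlobalCardinality

/-- Assignments `x ∈ {±1}ⁿ`. -/
abbrev Assignment (n : ℕ) : Type := Fin n → ℤˣ

/-- The entry `x i ∈ {±1}` as a real number. -/
def coord {n : ℕ} (x : Assignment n) (i : Fin n) : ℝ := ((x i : ℤ) : ℝ)

/-- The `p`-biased character
`φ i = √(p/(1-p))` if `x i = 1` and `φ i = -√((1-p)/p)` if `x i = -1`. -/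
def biasedChar (p : ℝ) {n : ℕ} (x : Assignment n) (i : Fin n) : ℝ :=
  if x i = 1 then Real.sqrt (p / (1 - p)) else -Real.sqrt ((1 - p) / p)

open Classical in
/-- The assignments complying with the global cardinality constraint `∑ i, x i = (1 - 2p) n`. -/
def slice (p : ℝ) (n : ℕ) : Finset (Assignment n) :=
  Finset.univ.filter fun x => ∑ i, coord x i = (1 - 2 * p) * (n : ℝ)

/-- Expectation under `D_p`, the uniform distribution on the assignments complying with
`∑ i, x i = (1 - 2p) n`. -/
def expectD (p : ℝ) {n : ℕ} (F : Assignment n → ℝ) : ℝ :=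
  Finset.expect (slice p n) F

/-- Expectation under `U_p`, the product distribution on `{±1}ⁿ` in which each bit is `-1` with
probability `p` and `1` with probability `1 - p`. -/
def expectU (p : ℝ) {n : ℕ} (F : Assignment n → ℝ) : ℝ :=
  ∑ x : Assignment n, (∏ i, if x i = 1 then 1 - p else p) * F x

/-- The `L₂` norm `‖F‖₂ = E_{U_p}[F²]^{1/2}`. -/
def normU (p : ℝ) {n : ℕ} (F : Assignment n → ℝ) : ℝ :=
  Real.sqrt (expectU p fun x => F x ^ 2)

/-- A multilinear polynomial: every variable has exponent at most `1` in every monomial. -/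
def IsMultilinear {n : ℕ} (f : MvPolynomial (Fin n) ℝ) : Prop :=
  f ∈ MvPolynomial.restrictDegree (Fin n) ℝ 1

end GlobalCardinality

end

/-! Identify an assignment with the set `A` of coordinates where it equals `-1`. Both `φ i` and `x
i` are affine in `1[i ∈ A]`, so all three claims concern functions of degree at most `d` in these
indicators, and `D_p` is uniform on sets of size `k = p n`.

Fourth moments pass from the slice to the product measure. The average of a function of degree `m`
over the sets of size `j` is a polynomial in `j` of degree at most `m`
(`exists_polynomial_sliceExpect`), and the `U_p` expectation is the binomial average of these slice
averages. For `F ^ 4` this polynomial is nonnegative on `{0, …, n}` and has degree at most `4 d`, so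
it cannot peak sharply at the mean `k`: its value there is at most `12 * 15 ^ d` times its binomial
average (`eval_mean_le_binomial`). The biased Bonami lemma (`biasedExpect_fourth_moment_le`) then
bounds `E_U[F ^ 4]` by `E_U[F ^ 2] ^ 2`, which gives the first claim.

For the other two claims `E_U[F ^ 2]` must be replaced by the second moment on the slice. This fails
for a general `F`, which may vanish on the slice, but `F` can be replaced there by a harmonic
polynomial of degree at most `d`. Under any exchangeable law a harmonic polynomial has a diagonal
second moment (`IsHarmonic.second_moment`), and comparing the diagonal weights of the two laws term
by term costs only `e ^ d` (`exists_extension`). -/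

namespace GlobalCardinality

open Finset

/-! ### Low-degree functions under the biased product measure and Bonami's lemma. -/

section Cube

variable {α : Type*} [DecidableEq α]

/-- The monomial `∏ i ∈ S, 1[i ∈ A]` as a function of the set `A`. -/
def subsetInd (S A : Finset α) : ℝ := if S ⊆ A then 1 else 0

/-- Functions of `A` spanned by the monomials of degree at most `d` in the variables from `s`. -/
def lowDegree (s : Finset α) (d : ℕ) : Submodule ℝ (Finset α → ℝ) :=
  Submodule.span ℝ {F | ∃ S ⊆ s, #S ≤ d ∧ F = subsetInd S}

/-- Expectation over the random subset of `s` containing each element independently with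
probability `p`. -/
def biasedExpect (p : ℝ) (s : Finset α) : (Finset α → ℝ) →ₗ[ℝ] ℝ :=
  ∑ A ∈ s.powerset, (p ^ #A * (1 - p) ^ #(s \ A)) • LinearMap.proj A

theorem biasedExpect_apply (p : ℝ) (s : Finset α) (F : Finset α → ℝ) :
    biasedExpect p s F = ∑ A ∈ s.powerset, p ^ #A * (1 - p) ^ #(s \ A) * F A := by
  simp [biasedExpect, LinearMap.sum_apply]

theorem subsetInd_mul (S T : Finset α) :
    subsetInd S * subsetInd T = subsetInd (S ∪ T) := by
  ext A
  by_cases h1 : S ⊆ A <;> by_cases h2 : T ⊆ A <;> simp [subsetInd, union_subset_iff, h1, h2]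

theorem subsetInd_empty : subsetInd (∅ : Finset α) = 1 := by
  ext A; simp [subsetInd]

theorem subsetInd_mem {s S : Finset α} {d : ℕ} (hS : S ⊆ s) (hd : #S ≤ d) :
    subsetInd S ∈ lowDegree s d :=
  Submodule.subset_span ⟨S, hS, hd, rfl⟩

theorem lowDegree_mono (s : Finset α) {d e : ℕ} (h : d ≤ e) : lowDegree s d ≤ lowDegree s e :=
  Submodule.span_mono fun _ ⟨S, hS, hd, hF⟩ => ⟨S, hS, hd.trans h, hF⟩

theorem one_mem_lowDegree (s : Finset α) (d : ℕ) : (1 : Finset α → ℝ) ∈ lowDegree s d := by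
  rw [← subsetInd_empty]
  exact subsetInd_mem (empty_subset s) (by simp)

theorem mul_mem_lowDegree {s : Finset α} {d e : ℕ} {F G : Finset α → ℝ}
    (hF : F ∈ lowDegree s d) (hG : G ∈ lowDegree s e) : F * G ∈ lowDegree s (d + e) := by
  induction hF using Submodule.span_induction with
  | mem F hF =>
    obtain ⟨S, hS, hd, rfl⟩ := hF
    induction hG using Submodule.span_induction with
    | mem G hG =>
      obtain ⟨T, hT, he, rfl⟩ := hG
      rw [subsetInd_mul]
      exact subsetInd_mem (union_subset hS hT) ((card_union_le S T).trans (by omega))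
    | zero => simp
    | add G G' _ _ h h' => rw [mul_add]; exact add_mem h h'
    | smul c G _ h => rw [mul_smul_comm]; exact Submodule.smul_mem _ c h
  | zero => simp
  | add F F' _ _ h h' => rw [add_mul]; exact add_mem h h'
  | smul c F _ h => rw [smul_mul_assoc]; exact Submodule.smul_mem _ c h

theorem pow_mem_lowDegree {s : Finset α} {d : ℕ} {F : Finset α → ℝ}
    (hF : F ∈ lowDegree s d) (m : ℕ) : F ^ m ∈ lowDegree s (m * d) := by
  induction m with
  | zero => simpa using one_mem_lowDegree s (0 * d)
  | succ m ih => rw [pow_succ, Nat.succ_mul]; exact mul_mem_lowDegree ih hF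

theorem biasedExpect_insert (p : ℝ) {s : Finset α} {a : α} (ha : a ∉ s) (F : Finset α → ℝ) :
    biasedExpect p (insert a s) F =
      biasedExpect p s fun A => (1 - p) * F A + p * F (insert a A) := by
  simp only [biasedExpect_apply]
  rw [sum_powerset_insert ha, ← sum_add_distrib]
  refine sum_congr rfl fun A hA => ?_
  have haA : a ∉ A := fun h => ha (mem_powerset.1 hA h)
  rw [insert_sdiff_of_notMem _ haA, card_insert_of_notMem (by simp [ha]),
    card_insert_of_notMem haA, insert_sdiff_insert, sdiff_insert_of_notMem ha]
  ring

theorem biasedExpect_mono {p : ℝ} (hp0 : 0 ≤ p) (hp1 : p ≤ 1) {s : Finset α}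
    {F G : Finset α → ℝ} (h : ∀ A ⊆ s, F A ≤ G A) : biasedExpect p s F ≤ biasedExpect p s G := by
  simp only [biasedExpect_apply]
  refine sum_le_sum fun A hA => mul_le_mul_of_nonneg_left (h A (mem_powerset.1 hA)) ?_
  have := sub_nonneg.2 hp1
  positivity

theorem biasedExpect_congr {p : ℝ} {s : Finset α}
    {F G : Finset α → ℝ} (h : ∀ A ⊆ s, F A = G A) : biasedExpect p s F = biasedExpect p s G := by
  simp only [biasedExpect_apply]
  exact sum_congr rfl fun A hA => by rw [h A (mem_powerset.1 hA)]

theorem biasedExpect_nonneg {p : ℝ} (hp0 : 0 ≤ p) (hp1 : p ≤ 1) {s : Finset α}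
    {F : Finset α → ℝ} (h : ∀ A, 0 ≤ F A) : 0 ≤ biasedExpect p s F := by
  simpa using biasedExpect_mono hp0 hp1 (s := s) (F := 0) (G := F) fun A _ => h A

theorem biasedExpect_one (p : ℝ) (s : Finset α) : biasedExpect p s 1 = 1 := by
  induction s using Finset.induction with
  | empty => simp [biasedExpect_apply]
  | insert a s ha ih =>
    rw [biasedExpect_insert p ha]
    refine (congrArg _ ?_).trans ih
    ext A
    simp

theorem biasedExpect_cauchy_schwarz {p : ℝ} (hp0 : 0 ≤ p) (hp1 : p ≤ 1) (s : Finset α)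
    (F G : Finset α → ℝ) :
    biasedExpect p s (F * G) ^ 2 ≤ biasedExpect p s (F ^ 2) * biasedExpect p s (G ^ 2) := by
  simp only [biasedExpect_apply]
  have hw : ∀ A, 0 ≤ p ^ #A * (1 - p) ^ #(s \ A) := fun A => by
    have := sub_nonneg.2 hp1
    positivity
  refine sum_sq_le_sum_mul_sum_of_sq_le_mul _ (fun A _ => ?_) (fun A _ => ?_)
    fun A _ => le_of_eq ?_
  · exact mul_nonneg (hw A) (sq_nonneg _)
  · exact mul_nonneg (hw A) (sq_nonneg _)
  · simp only [Pi.mul_apply, Pi.pow_apply]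
    ring

/-- This isolates one variable for the induction in Bonami's lemma. Taking `c = p` centres the
indicator of `a`, so the cross term disappears from the second moment. -/
theorem lowDegree_insert {s : Finset α} {a : α} {d : ℕ} {F : Finset α → ℝ} (c : ℝ)
    (hF : F ∈ lowDegree (insert a s) (d + 1)) :
    ∃ G ∈ lowDegree s (d + 1), ∃ H ∈ lowDegree s d,
      F = G + (fun A => subsetInd {a} A - c) * H := by
  induction hF using Submodule.span_induction with
  | mem F hF =>
    obtain ⟨S, hS, hd, rfl⟩ := hF
    by_cases haS : a ∈ S
    · have h1 : S.erase a ⊆ s := by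
        intro x hx
        have := hS (mem_of_mem_erase hx)
        rw [mem_insert] at this
        exact this.resolve_left (ne_of_mem_erase hx)
      have h2 : #(S.erase a) ≤ d := by rw [card_erase_of_mem haS]; omega
      refine ⟨c • subsetInd (S.erase a), Submodule.smul_mem _ _ (subsetInd_mem h1 (by omega)),
        subsetInd (S.erase a), subsetInd_mem h1 h2, ?_⟩
      have h3 : subsetInd S = subsetInd {a} * subsetInd (S.erase a) := by
        rw [subsetInd_mul, ← insert_eq, insert_erase haS]
      ext A
      simp only [h3, Pi.mul_apply, Pi.add_apply, Pi.smul_apply, smul_eq_mul]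
      ring
    · exact ⟨subsetInd S, subsetInd_mem ((subset_insert_iff_of_notMem haS).1 hS) hd, 0,
        zero_mem _, by simp⟩
  | zero => exact ⟨0, zero_mem _, 0, zero_mem _, by simp⟩
  | add F F' _ _ h h' =>
    obtain ⟨G, hG, H, hH, rfl⟩ := h
    obtain ⟨G', hG', H', hH', rfl⟩ := h'
    exact ⟨G + G', add_mem hG hG', H + H', add_mem hH hH', by ring⟩
  | smul r F _ h =>
    obtain ⟨G, hG, H, hH, rfl⟩ := h
    exact ⟨r • G, Submodule.smul_mem _ _ hG, r • H, Submodule.smul_mem _ _ hH, by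
      rw [smul_add, mul_smul_comm]⟩

theorem eq_const_of_mem_lowDegree_zero {s : Finset α} {F : Finset α → ℝ}
    (hF : F ∈ lowDegree s 0) : ∃ c : ℝ, F = c • 1 := by
  induction hF using Submodule.span_induction with
  | mem F hF =>
    obtain ⟨S, -, hd, rfl⟩ := hF
    rw [card_eq_zero.1 (Nat.le_zero.1 hd)]
    exact ⟨1, by simp [subsetInd_empty]⟩
  | zero => exact ⟨0, by simp⟩
  | add F F' _ _ h h' =>
    obtain ⟨c, rfl⟩ := h
    obtain ⟨c', rfl⟩ := h'
    exact ⟨c + c', by rw [add_smul]⟩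
  | smul r F _ h =>
    obtain ⟨c, rfl⟩ := h
    exact ⟨r * c, by rw [mul_smul]⟩

theorem lowDegree_apply_insert {s : Finset α} {a : α} (ha : a ∉ s) {d : ℕ} {F : Finset α → ℝ}
    (hF : F ∈ lowDegree s d) (A : Finset α) : F (insert a A) = F A := by
  induction hF using Submodule.span_induction with
  | mem F hF =>
    obtain ⟨S, hS, -, rfl⟩ := hF
    have : a ∉ S := fun h => ha (hS h)
    simp [subsetInd, subset_insert_iff_of_notMem this]
  | zero => simp
  | add F F' _ _ h h' => simp [h, h']
  | smul r F _ h => simp [h]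

/-- With `v = p * (1 - p)`, the centred bit has second, third and fourth moments `v`, `v * (1 - 2 *
p)` and `v * (1 - 3 * v)`. The right side is chosen so that it exceeds the left by exactly `2 * y ^
2 * ((1 - 2 * p) * x - v * y) ^ 2`, which absorbs the odd term `x * y ^ 3`. -/
theorem two_point_fourth_moment_le {p : ℝ} (hp1 : p ≤ 1) (x y : ℝ) :
    (1 - p) * (x - p * y) ^ 4 + p * (x + (1 - p) * y) ^ 4 ≤
      x ^ 4 + 2 * (1 - p * (1 - p)) * (x ^ 2 * y ^ 2) +
        p * (1 - p) * (1 - p * (1 - p)) * y ^ 4 := by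
  have hq := sub_nonneg.2 hp1
  have h : 0 ≤ 2 * y ^ 2 * ((1 - 2 * p) * x - p * (1 - p) * y) ^ 2 := by positivity
  nlinarith [h]

/-- Bonami's lemma for biased product distributions. -/
theorem biasedExpect_fourth_moment_le {p : ℝ} (hp0 : 0 < p) (hp1 : p < 1) (s : Finset α) :
    ∀ (d : ℕ) (F : Finset α → ℝ), F ∈ lowDegree s d →
      biasedExpect p s (F ^ 4) ≤
        (((1 - p * (1 - p)) / (p * (1 - p))) ^ d * biasedExpect p s (F ^ 2)) ^ 2 := by
  have hq := sub_pos.2 hp1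
  have hv : 0 < p * (1 - p) := by positivity
  have hv4 : p * (1 - p) ≤ 1 / 4 := by nlinarith [sq_nonneg (2 * p - 1)]
  set v := p * (1 - p) with hvdef
  have hκ : 1 ≤ (1 - v) / v := by rw [le_div_iff₀ hv]; linarith
  have hconst : ∀ (s : Finset α) (F : Finset α → ℝ), F ∈ lowDegree s 0 → ∀ d : ℕ,
      biasedExpect p s (F ^ 4) ≤ (((1 - v) / v) ^ d * biasedExpect p s (F ^ 2)) ^ 2 := by
    intro s F hF d
    obtain ⟨c, rfl⟩ := eq_const_of_mem_lowDegree_zero hF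
    have h1 : ∀ m, biasedExpect p s ((c • (1 : Finset α → ℝ)) ^ m) = c ^ m := fun m => by
      rw [smul_pow, one_pow, map_smul, biasedExpect_one, smul_eq_mul, mul_one]
    rw [h1, h1]
    calc c ^ 4 = (1 * c ^ 2) ^ 2 := by ring
      _ ≤ _ := by gcongr; exact one_le_pow₀ hκ
  induction s using Finset.induction with
  | empty =>
    intro d F hF
    refine hconst ∅ F ?_ d
    refine Submodule.span_mono ?_ hF
    rintro F ⟨S, hS, -, rfl⟩
    exact ⟨S, hS, by simp [subset_empty.1 hS], rfl⟩
  | insert a s ha ih =>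
    intro d F hF
    rcases d with _ | d
    · exact hconst _ F hF 0
    obtain ⟨G, hG, H, hH, rfl⟩ := lowDegree_insert p hF
    set κ := (1 - v) / v with hκdef
    have hκv : κ * v = 1 - v := div_mul_cancel₀ _ hv.ne'
    have hout : ∀ A ⊆ s, (G + (fun A => subsetInd {a} A - p) * H) A = G A - p * H A := by
      intro A hA
      have : a ∉ A := fun h => ha (hA h)
      simp [subsetInd, this]
      ring
    have hin : ∀ A ⊆ s, (G + (fun A => subsetInd {a} A - p) * H) (insert a A) =
        G A + (1 - p) * H A := by
      intro A _
      simp [subsetInd, lowDegree_apply_insert ha hG, lowDegree_apply_insert ha hH]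
    have e2 : biasedExpect p (insert a s) ((G + (fun A => subsetInd {a} A - p) * H) ^ 2) =
        biasedExpect p s (G ^ 2) + v * biasedExpect p s (H ^ 2) := by
      rw [biasedExpect_insert p ha, ← smul_eq_mul v, ← map_smul, ← map_add]
      refine biasedExpect_congr fun A hA => ?_
      rw [Pi.pow_apply, Pi.pow_apply, hout A hA, hin A hA]
      simp only [Pi.add_apply, Pi.smul_apply, Pi.pow_apply, smul_eq_mul, hvdef]
      ring
    have e4 : biasedExpect p (insert a s) ((G + (fun A => subsetInd {a} A - p) * H) ^ 4) ≤
        biasedExpect p s (G ^ 4) + 2 * (1 - v) * biasedExpect p s (G ^ 2 * H ^ 2) +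
          v * (1 - v) * biasedExpect p s (H ^ 4) := by
      rw [biasedExpect_insert p ha, ← smul_eq_mul (2 * (1 - v)), ← smul_eq_mul (v * (1 - v)),
        ← map_smul, ← map_smul, ← map_add, ← map_add]
      refine biasedExpect_mono hp0.le hp1.le fun A hA => ?_
      rw [Pi.pow_apply, Pi.pow_apply, hout A hA, hin A hA]
      exact two_point_fourth_moment_le hp1.le (G A) (H A)
    rw [e2]
    refine e4.trans ?_
    have hG4 := ih (d + 1) G hG
    have hH4 := ih d H hH
    have hg : 0 ≤ biasedExpect p s (G ^ 2) :=
      biasedExpect_nonneg hp0.le hp1.le fun A => sq_nonneg (G A)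
    have hh : 0 ≤ biasedExpect p s (H ^ 2) :=
      biasedExpect_nonneg hp0.le hp1.le fun A => sq_nonneg (H A)
    set g := biasedExpect p s (G ^ 2)
    set h := biasedExpect p s (H ^ 2)
    have hcs := biasedExpect_cauchy_schwarz hp0.le hp1.le s (G ^ 2) (H ^ 2)
    rw [← pow_mul, ← pow_mul] at hcs
    have hκ0 : 0 < κ := by linarith
    have hH0 : 0 ≤ biasedExpect p s (H ^ 4) :=
      biasedExpect_nonneg hp0.le hp1.le fun A => by
        rw [Pi.pow_apply]; positivity
    have hcross : biasedExpect p s (G ^ 2 * H ^ 2) ≤ κ ^ (d + 1) * g * (κ ^ d * h) := by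
      refine le_of_sq_le_sq ?_ (by positivity)
      refine hcs.trans ?_
      rw [mul_pow (κ ^ (d + 1) * g)]
      exact mul_le_mul hG4 hH4 hH0 (by positivity)
    have hv1 : 0 ≤ 1 - v := by linarith
    -- Since `v ≤ 1 - v`, one factor `v` in the last term may be enlarged. Then `κ * v = 1 - v`
    -- makes the whole a perfect square, `(κ ^ (d + 1) * (g + v * h)) ^ 2`. This is what fixes the
    -- value of `κ`.
    calc _ ≤ (κ ^ (d + 1) * g) ^ 2 + 2 * (1 - v) * (κ ^ (d + 1) * g * (κ ^ d * h)) +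
          v * (1 - v) * (κ ^ d * h) ^ 2 := by gcongr
      _ ≤ (κ ^ (d + 1) * g) ^ 2 + 2 * (1 - v) * (κ ^ (d + 1) * g * (κ ^ d * h)) +
          (1 - v) * (1 - v) * (κ ^ d * h) ^ 2 := by
        gcongr
        linarith
      _ = _ := by
        rw [← hκv]
        ring

end Cube

/-! ### Binomial weights near an integral mean. -/

section Binomial

/-- The probability that a binomial variable with parameters `n` and `p` equals `j`. -/
def binomialWeight (p : ℝ) (n j : ℕ) : ℝ := n.choose j * p ^ j * (1 - p) ^ (n - j)

theorem binomialWeight_nonneg {p : ℝ} (hp0 : 0 ≤ p) (hp1 : p ≤ 1) (n j : ℕ) :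
    0 ≤ binomialWeight p n j := by
  have := sub_nonneg.2 hp1
  unfold binomialWeight
  positivity

theorem eval_bernsteinPolynomial (p : ℝ) (n j : ℕ) :
    (bernsteinPolynomial ℝ n j).eval p = binomialWeight p n j := by
  simp [bernsteinPolynomial, binomialWeight]

theorem sum_binomialWeight (p : ℝ) (n : ℕ) :
    ∑ j ∈ range (n + 1), binomialWeight p n j = 1 := by
  have := congrArg (Polynomial.eval p) (bernsteinPolynomial.sum ℝ n)
  simpa [Polynomial.eval_finsetSum, eval_bernsteinPolynomial] using this

theorem sum_binomialWeight_mul_sq (p : ℝ) (n : ℕ) :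
    ∑ j ∈ range (n + 1), binomialWeight p n j * (j - p * n) ^ 2 = n * p * (1 - p) := by
  have := congrArg (Polynomial.eval p) (bernsteinPolynomial.variance ℝ n)
  simp only [Polynomial.eval_finsetSum, Polynomial.eval_mul, Polynomial.eval_pow,
    Polynomial.eval_sub, eval_bernsteinPolynomial, nsmul_eq_mul, Polynomial.eval_natCast,
    Polynomial.eval_X, Polynomial.eval_one] at this
  rw [← this]
  exact sum_congr rfl fun j _ => by ring

theorem binomialWeight_symm (p : ℝ) {n j : ℕ} (hj : j ≤ n) :
    binomialWeight (1 - p) n (n - j) = binomialWeight p n j := by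
  unfold binomialWeight
  rw [Nat.choose_symm hj, Nat.sub_sub_self hj, sub_sub_cancel]
  ring

theorem binomialWeight_succ {p : ℝ} {n j : ℕ} (hj : j < n) :
    binomialWeight p n (j + 1) * ((j + 1) * (1 - p)) = binomialWeight p n j * ((n - j) * p) := by
  have h := Nat.choose_succ_right_eq n j
  have h' : (n.choose (j + 1) : ℝ) * (j + 1) = n.choose j * (n - j) := by
    rw [← Nat.cast_sub hj.le]
    exact_mod_cast h
  have hsub : n - j = n - (j + 1) + 1 := by omega
  unfold binomialWeight
  rw [hsub, pow_succ p, pow_succ (1 - p)]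
  linear_combination p ^ j * p * (1 - p) ^ (n - (j + 1)) * (1 - p) * h'

/-- The ratio of consecutive weights is `(k * (1 - p) - t * p) / ((k + t + 1) * (1 - p))`, at most
`1`. Multiplied by the variance `k * (1 - p)`, the drop at step `t` is at most `t + 1` times the
central weight, and these drops add up to `t * (t + 1) / 2`. -/
theorem binomialWeight_add_bounds {p : ℝ} (hp0 : 0 < p) (hp1 : p < 1) {n k : ℕ}
    (hk : p * n = k) (t : ℕ) (ht : k + t ≤ n) :
    binomialWeight p n (k + t) ≤ binomialWeight p n k ∧
      binomialWeight p n k * (k * (1 - p) - t * (t + 1) / 2) ≤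
        k * (1 - p) * binomialWeight p n (k + t) := by
  have hq := sub_pos.2 hp1
  induction t with
  | zero => simp [mul_comm]
  | succ t ih =>
    obtain ⟨ih1, ih2⟩ := ih (by omega)
    have hs := binomialWeight_succ (p := p) (show k + t < n by omega)
    rw [← add_assoc]
    have h0 := binomialWeight_nonneg hp0.le hp1.le n (k + t)
    have h1 := binomialWeight_nonneg hp0.le hp1.le n (k + t + 1)
    have hk0 := binomialWeight_nonneg hp0.le hp1.le n k
    set w := binomialWeight p n (k + t)
    set w' := binomialWeight p n (k + t + 1)
    set w0 := binomialWeight p n k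
    push_cast at hs ⊢
    have hkr : (0 : ℝ) ≤ k := by positivity
    have htr : (0 : ℝ) ≤ t := by positivity
    have hnp : ((n : ℝ) - (k + t)) * p = k * (1 - p) - t * p := by rw [← hk]; ring
    rw [hnp] at hs
    have hmono : w' ≤ w := by
      have h2 : 0 < (k + t + 1 : ℝ) * (1 - p) := by positivity
      by_contra hlt
      push Not at hlt
      nlinarith [mul_lt_mul_of_pos_right hlt h2, mul_nonneg h0 (mul_nonneg htr hp0.le),
        mul_nonneg h0 (mul_nonneg (add_nonneg htr zero_le_one) hq.le)]
    refine ⟨hmono.trans ih1, ?_⟩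
    have key : k * (1 - p) * w' ≥ k * (1 - p) * w - (t + 1) * w := by
      have : k * (1 - p) * w' = k * (1 - p) * w - t * p * w - (t + 1) * (1 - p) * w' := by
        linear_combination hs
      rw [this]
      nlinarith [mul_le_mul_of_nonneg_left hmono (mul_nonneg (add_nonneg htr zero_le_one) hq.le),
        mul_nonneg h0 hp0.le]
    nlinarith [mul_le_mul_of_nonneg_left ih1 (add_nonneg htr zero_le_one)]

theorem binomialWeight_bounds {p : ℝ} (hp0 : 0 < p) (hp1 : p < 1) {n k : ℕ}
    (hk : p * n = k) {j t : ℕ} (hj : j ≤ n) (h1 : j ≤ k + t) (h2 : k ≤ j + t) :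
    binomialWeight p n j ≤ binomialWeight p n k ∧
      binomialWeight p n k * (k * (1 - p) - t * (t + 1) / 2) ≤
        k * (1 - p) * binomialWeight p n j := by
  have hkn : k ≤ n := by
    have : (k : ℝ) ≤ n := by rw [← hk]; nlinarith [(Nat.cast_nonneg n : (0 : ℝ) ≤ n)]
    exact_mod_cast this
  have hw := binomialWeight_nonneg hp0.le hp1.le n k
  have hmono : ∀ u : ℕ, u ≤ t →
      binomialWeight p n k * (k * (1 - p) - t * (t + 1) / 2) ≤
        binomialWeight p n k * (k * (1 - p) - u * (u + 1) / 2) := by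
    intro u hu
    have : (u : ℝ) ≤ t := by exact_mod_cast hu
    gcongr
  rcases le_total k j with h | h
  · obtain ⟨u, rfl⟩ := Nat.exists_eq_add_of_le h
    obtain ⟨ha, hb⟩ := binomialWeight_add_bounds hp0 hp1 hk u hj
    exact ⟨ha, (hmono u (by omega)).trans hb⟩
  · obtain ⟨u, rfl⟩ := Nat.exists_eq_add_of_le h
    have hk' : (1 - p) * n = ((n - (j + u) : ℕ) : ℝ) := by
      rw [Nat.cast_sub hkn, ← hk]; ring
    obtain ⟨ha, hb⟩ := binomialWeight_add_bounds (p := 1 - p) (by linarith) (by linarith) hk' u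
      (by omega)
    have e : n - (j + u) + u = n - j := by omega
    have e' : ((n - (j + u) : ℕ) : ℝ) * (1 - (1 - p)) = ((j + u : ℕ) : ℝ) * (1 - p) := by
      rw [Nat.cast_sub hkn]
      linear_combination hk
    rw [e, binomialWeight_symm p hj, binomialWeight_symm p hkn] at ha hb
    rw [e'] at hb
    exact ⟨ha, (hmono u (by omega)).trans hb⟩

/-- A lower bound for the binomial distribution at an integral mean. -/
theorem binomialWeight_mean_lower {p : ℝ} (hp0 : 0 < p) (hp1 : p < 1) {n k : ℕ}
    (hk : p * n = k) {σ : ℝ} (hσ0 : 0 ≤ σ) (hσ : σ ^ 2 = k * (1 - p)) :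
    3 / 4 ≤ binomialWeight p n k * (4 * σ + 1) := by
  have hkn : k ≤ n := by
    have : (k : ℝ) ≤ n := by rw [← hk]; nlinarith [(Nat.cast_nonneg n : (0 : ℝ) ≤ n)]
    exact_mod_cast this
  have hw := binomialWeight_nonneg hp0.le hp1.le n
  -- By Chebyshev, the points within two standard deviations of the mean carry mass at least `3 /
  -- 4`. There are at most `2 * m + 1 ≤ 4 * σ + 1` of them, and none outweighs the mean.
  set m := ⌊2 * σ⌋₊ with hm
  have hmle : (m : ℝ) ≤ 2 * σ := Nat.floor_le (by positivity)
  have hmlt : 2 * σ < m + 1 := Nat.lt_floor_add_one _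
  have hvar := sum_binomialWeight_mul_sq p n
  have hsum := sum_binomialWeight p n
  have hvar' : (n : ℝ) * p * (1 - p) = σ ^ 2 := by rw [hσ, ← hk]; ring
  rw [hvar'] at hvar
  have hpt : ∀ j ∈ range (n + 1), 4 * σ ^ 2 * binomialWeight p n j ≤
      4 * σ ^ 2 * (if j ∈ Icc (k - m) (k + m) then binomialWeight p n k else 0) +
        binomialWeight p n j * (j - p * n) ^ 2 := by
    intro j hj
    have hjn : j ≤ n := by simpa [Nat.lt_succ_iff] using hj
    split_ifs with h
    · rw [mem_Icc] at h
      have := (binomialWeight_bounds hp0 hp1 hk (t := m) hjn (by omega) (by omega)).1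
      have h3 : 0 ≤ binomialWeight p n j * (j - p * n) ^ 2 := mul_nonneg (hw j) (sq_nonneg _)
      nlinarith [mul_le_mul_of_nonneg_left this (by positivity : 0 ≤ 4 * σ ^ 2)]
    · have h4 : (2 * σ) ^ 2 ≤ ((j : ℝ) - p * n) ^ 2 := by
        rw [hk]
        rw [mem_Icc, not_and_or] at h
        apply sq_le_sq.2
        rw [abs_of_nonneg (by positivity)]
        rcases h with h | h
        · have : ((j + m + 1 : ℕ) : ℝ) ≤ k := by exact_mod_cast (by omega : j + m + 1 ≤ k)
          push_cast at this
          rw [abs_of_nonpos (by linarith)]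
          linarith
        · have : ((k + m + 1 : ℕ) : ℝ) ≤ j := by exact_mod_cast (by omega : k + m + 1 ≤ j)
          push_cast at this
          rw [abs_of_nonneg (by linarith)]
          linarith
      nlinarith [mul_le_mul_of_nonneg_left h4 (hw j)]
  have hall := sum_le_sum hpt
  rw [← mul_sum, sum_add_distrib, hsum, hvar, ← mul_sum, ← sum_filter, sum_const,
    nsmul_eq_mul] at hall
  have hcard : ((#{j ∈ range (n + 1) | j ∈ Icc (k - m) (k + m)} : ℕ) : ℝ) ≤ 4 * σ + 1 := by
    have h5 : #{j ∈ range (n + 1) | j ∈ Icc (k - m) (k + m)} ≤ #(Icc (k - m) (k + m)) :=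
      card_le_card fun j hj => (mem_filter.1 hj).2
    rw [Nat.card_Icc] at h5
    have h6 : ((#{j ∈ range (n + 1) | j ∈ Icc (k - m) (k + m)} : ℕ) : ℝ) ≤ ((2 * m + 1 : ℕ) : ℝ) := by
      exact_mod_cast h5.trans (by omega)
    push_cast at h6
    linarith
  -- Chebyshev is empty when `σ = 0`. That case forces `k = n = 0`, where the weight is `1`.
  rcases hσ0.eq_or_lt with h0 | h0
  · have hk0 : (k : ℝ) = 0 := by
      rw [← h0] at hσ
      nlinarith [sub_pos.2 hp1, (Nat.cast_nonneg k : (0 : ℝ) ≤ k)]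
    have hn0 : n = 0 := by
      have : (n : ℝ) = 0 := by
        rw [hk0] at hk
        exact (mul_eq_zero.1 hk).resolve_left hp0.ne'
      exact_mod_cast this
    have hk0' : k = 0 := by exact_mod_cast hk0
    rw [← h0, hn0, hk0']
    norm_num [binomialWeight]
  · have h7 := mul_le_mul_of_nonneg_right hcard (hw k)
    have hσ2 : 0 < σ ^ 2 := by positivity
    have : 4 * σ ^ 2 * (3 / 4) ≤ 4 * σ ^ 2 * (binomialWeight p n k * (4 * σ + 1)) := by
      nlinarith [mul_le_mul_of_nonneg_left h7 (by positivity : 0 ≤ 4 * σ ^ 2)]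
    exact le_of_mul_le_mul_left this (by positivity)

end Binomial

/-! ### Nonnegative polynomials at the binomial mean. -/

section Univariate

open Polynomial in
/-- Vanishing symmetric differences bound a polynomial at the centre of an arithmetic progression
on which it is nonnegative. -/
theorem eval_le_sum_symmetric (P : ℝ[X]) {l : ℕ} (hP : P.natDegree < 2 * l) (x h : ℝ)
    (hpos : ∀ i ∈ range (2 * l + 1), 0 ≤ P.eval (x + ((i : ℝ) - l) * h)) :
    P.eval x ≤ ∑ i ∈ (range (2 * l + 1)).erase l, P.eval (x + ((i : ℝ) - l) * h) := by
  set R : ℝ[X] := P.comp (C (x - l * h) + C h * X) with hR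
  have hdeg : R.natDegree < 2 * l := by
    refine lt_of_le_of_lt ?_ hP
    refine natDegree_comp_le.trans ?_
    have : (C (x - l * h) + C h * X : ℝ[X]).natDegree ≤ 1 := by
      rw [add_comm]; exact natDegree_linear_le
    exact (Nat.mul_le_mul_left _ this).trans (by simp)
  -- The vanishing `2 l`-th difference expresses `P(x)` through the other points, with coefficients
  -- `± (2l choose i) / (2l choose l)`. These have absolute value at most `1` because the central
  -- binomial coefficient is the largest.
  have h0 := congrFun (Polynomial.fwdDiff_iter_eq_zero_of_degree_lt hdeg) 0
  rw [fwdDiff_iter_eq_sum_shift] at h0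
  have heval : ∀ i : ℕ, R.eval ((0 : ℝ) + i • (1 : ℝ)) = P.eval (x + ((i : ℝ) - l) * h) := by
    intro i
    simp only [hR, eval_comp, eval_add, eval_mul, eval_C, eval_X, zero_add, nsmul_eq_mul, mul_one]
    congr 1
    ring
  simp only [heval, zsmul_eq_mul, Pi.zero_apply] at h0
  have hl : l ∈ range (2 * l + 1) := by rw [mem_range]; omega
  rw [← add_sum_erase _ _ hl, sub_self, zero_mul, add_zero] at h0
  push_cast at h0
  have hc : (0 : ℝ) < (2 * l).choose l := by
    exact_mod_cast Nat.choose_pos (by omega)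
  have h1 : (((2 * l).choose l : ℕ) : ℝ) * P.eval x =
      |∑ i ∈ (range (2 * l + 1)).erase l, (-1 : ℝ) ^ (2 * l - i) * ((2 * l).choose i : ℝ) *
        P.eval (x + ((i : ℝ) - l) * h)| := by
    have hx : 0 ≤ P.eval x := by simpa using hpos l hl
    rw [← abs_of_nonneg (mul_nonneg hc.le hx), ← abs_neg (∑ i ∈ _, _), ← eq_neg_of_add_eq_zero_left h0,
      abs_mul, abs_mul, abs_mul, abs_pow, abs_neg, abs_one, one_pow, one_mul]
  refine le_of_mul_le_mul_left ?_ hc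
  rw [h1, mul_sum]
  refine (abs_sum_le_sum_abs _ _).trans (sum_le_sum fun i hi => ?_)
  have hi' := hpos i (mem_of_mem_erase hi)
  rw [abs_mul, abs_mul, abs_pow, abs_neg, abs_one, one_pow, one_mul, abs_of_nonneg hi',
    abs_of_nonneg (by positivity)]
  refine mul_le_mul_of_nonneg_right ?_ hi'
  have := Nat.choose_le_middle i (2 * l)
  rw [Nat.mul_div_cancel_left _ (by norm_num)] at this
  exact_mod_cast this

-- Average `eval_le_sum_symmetric` at `k` over the `2 * H` nonzero steps `h ∈ [-H, H]`. For a fixed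
-- index `i ≠ l` the points `k + (i - l) * h` are distinct and within `l * H` of `k`, so their total
-- is at most `E / m`, where `E` is the weighted sum. There are `2 * l` such indices. The gain over
-- a single progression is the factor `H`.
open Polynomial in
theorem eval_le_of_weights_lower (P : ℝ[X]) {l : ℕ} (hP : P.natDegree < 2 * l) {n k H : ℕ}
    (hk : l * H ≤ k) (hn : k + l * H ≤ n) (hpos : ∀ j ≤ n, 0 ≤ P.eval (j : ℝ))
    (w : ℕ → ℝ) (hw : ∀ j, 0 ≤ w j) {m : ℝ}
    (hm : ∀ j, j ≤ k + l * H → k ≤ j + l * H → m ≤ w j) :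
    H * m * P.eval (k : ℝ) ≤ l * ∑ j ∈ range (n + 1), w j * P.eval (j : ℝ) := by
  rcases le_or_gt m 0 with hm0 | hm0
  · refine le_trans (b := 0) ?_ ?_
    · exact mul_nonpos_of_nonpos_of_nonneg
        (mul_nonpos_of_nonneg_of_nonpos (Nat.cast_nonneg H) hm0) (hpos k (by omega))
    · exact mul_nonneg (Nat.cast_nonneg l) (sum_nonneg fun j hj =>
        mul_nonneg (hw j) (hpos j (by rw [mem_range] at hj; omega)))
  set E := ∑ j ∈ range (n + 1), w j * P.eval (j : ℝ) with hE
  set S : Finset ℤ := (Icc (-(H : ℤ)) H).erase 0 with hS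
  have hbound : ∀ i ∈ range (2 * l + 1), ∀ h ∈ S,
      |((i : ℤ) - l) * h| ≤ l * H := by
    intro i hi h hh
    rw [hS, mem_erase, mem_Icc] at hh
    rw [mem_range] at hi
    rw [abs_mul]
    exact mul_le_mul (abs_le.2 ⟨by omega, by omega⟩) (abs_le.2 hh.2) (abs_nonneg _) (by positivity)
  let g : ℕ → ℤ → ℕ := fun i h => ((k : ℤ) + ((i : ℤ) - l) * h).toNat
  have hg : ∀ i ∈ range (2 * l + 1), ∀ h ∈ S,
      ((g i h : ℕ) : ℤ) = (k : ℤ) + ((i : ℤ) - l) * h ∧ g i h ≤ k + l * H ∧ k ≤ g i h + l * H := by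
    intro i hi h hh
    have := abs_le.1 (hbound i hi h hh)
    have hk' : (l : ℤ) * H ≤ k := by exact_mod_cast hk
    have e : ((g i h : ℕ) : ℤ) = (k : ℤ) + ((i : ℤ) - l) * h := Int.toNat_of_nonneg (by linarith)
    refine ⟨e, ?_, ?_⟩ <;> zify <;> rw [e] <;> linarith
  have hgr : ∀ i ∈ range (2 * l + 1), ∀ h ∈ S,
      (k : ℝ) + ((i : ℝ) - l) * h = (g i h : ℕ) := by
    intro i hi h hh
    have := (hg i hi h hh).1
    have h2 : (((g i h : ℕ) : ℤ) : ℝ) = (((k : ℤ) + ((i : ℤ) - l) * h : ℤ) : ℝ) := by rw [this]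
    push_cast at h2
    exact h2.symm
  have hinner : ∀ i ∈ (range (2 * l + 1)).erase l,
      m * ∑ h ∈ S, P.eval ((k : ℝ) + ((i : ℝ) - l) * h) ≤ E := by
    intro i hi
    obtain ⟨hil, hi⟩ := mem_erase.1 hi
    have hinj : Set.InjOn (g i) S := by
      intro a ha b hb hab
      have h1 := (hg i hi a ha).1
      have h2 := (hg i hi b hb).1
      rw [hab, h2] at h1
      have hne : (i : ℤ) - l ≠ 0 := by
        rw [sub_ne_zero]; exact_mod_cast hil
      exact (mul_left_cancel₀ hne (add_left_cancel h1)).symm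
    calc m * ∑ h ∈ S, P.eval ((k : ℝ) + ((i : ℝ) - l) * h)
        ≤ ∑ h ∈ S, w (g i h) * P.eval ((g i h : ℕ) : ℝ) := by
          rw [mul_sum]
          refine sum_le_sum fun h hh => ?_
          obtain ⟨-, h1, h2⟩ := hg i hi h hh
          rw [hgr i hi h hh]
          exact mul_le_mul_of_nonneg_right (hm _ h1 h2) (hpos _ (by omega))
      _ = ∑ j ∈ S.image (g i), w j * P.eval (j : ℝ) :=
          (sum_image (f := fun j : ℕ => w j * P.eval (j : ℝ)) hinj).symm
      _ ≤ E := by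
          refine sum_le_sum_of_subset_of_nonneg ?_ fun j hj _ => ?_
          · intro j hj
            obtain ⟨h, hh, rfl⟩ := mem_image.1 hj
            have := (hg i hi h hh).2.1
            rw [mem_range]
            omega
          · exact mul_nonneg (hw j) (hpos j (by rw [mem_range] at hj; omega))
  have houter : ∑ _h ∈ S, P.eval (k : ℝ) ≤
      ∑ h ∈ S, ∑ i ∈ (range (2 * l + 1)).erase l, P.eval ((k : ℝ) + ((i : ℝ) - l) * h) := by
    refine sum_le_sum fun h hh => eval_le_sum_symmetric P hP _ _ fun i hi => ?_
    rw [hgr i hi h hh]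
    have := (hg i hi h hh).2.1
    exact hpos _ (by omega)
  have hcard : #S = 2 * H := by
    rw [hS, card_erase_of_mem (by simp), Int.card_Icc]
    omega
  rw [sum_const, hcard, sum_comm, nsmul_eq_mul] at houter
  have h3 := sum_le_sum hinner
  rw [← mul_sum, sum_const, card_erase_of_mem (by rw [mem_range]; omega), card_range,
    nsmul_eq_mul] at h3
  push_cast [Nat.add_sub_cancel] at h3 houter
  have h4 := mul_le_mul_of_nonneg_left houter hm0.le
  linarith

open Polynomial in
/-- A polynomial of degree at most `4 d` that is nonnegative on `{0, …, n}` is bounded at the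
integral mean of a binomial distribution by a multiple of its expectation. -/
theorem eval_mean_le_binomial {p : ℝ} (hp0 : 0 < p) (hp1 : p < 1) {n k d : ℕ}
    (hk : p * n = k) (hd : 1 ≤ d) (P : ℝ[X]) (hP : P.natDegree ≤ 4 * d)
    (hpos : ∀ j ≤ n, 0 ≤ P.eval (j : ℝ)) :
    P.eval (k : ℝ) ≤
      12 * 15 ^ d * ∑ j ∈ range (n + 1), binomialWeight p n j * P.eval (j : ℝ) := by
  have hq := sub_pos.2 hp1
  have hkn : k ≤ n := by
    have : (k : ℝ) ≤ n := by rw [← hk]; nlinarith [(Nat.cast_nonneg n : (0 : ℝ) ≤ n)]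
    exact_mod_cast this
  have hw := binomialWeight_nonneg hp0.le hp1.le n
  set E := ∑ j ∈ range (n + 1), binomialWeight p n j * P.eval (j : ℝ) with hE
  have hEk : binomialWeight p n k * P.eval (k : ℝ) ≤ E :=
    single_le_sum (f := fun j : ℕ => binomialWeight p n j * P.eval (j : ℝ))
      (fun j hj => mul_nonneg (hw j) (hpos j (by rw [mem_range] at hj; omega)))
      (by rw [mem_range]; omega)
  have hPk := hpos k hkn
  have hE0 : 0 ≤ E := (mul_nonneg (hw k) hPk).trans hEk
  set σ := Real.sqrt (k * (1 - p)) with hσdef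
  have hσ0 : 0 ≤ σ := Real.sqrt_nonneg _
  have hσ : σ ^ 2 = k * (1 - p) := Real.sq_sqrt (by positivity)
  have hlow := binomialWeight_mean_lower hp0 hp1 hk hσ0 hσ
  -- The difference of order `2 * l = 4 * d + 2` kills degree `4 * d`.
  set l := 2 * d + 1 with hl
  have hlr : (l : ℝ) = 2 * d + 1 := by rw [hl]; push_cast; ring
  have hdr : (1 : ℝ) ≤ d := by exact_mod_cast hd
  -- When `σ` is small, the single term `j = k` of the expectation suffices, since its weight is at
  -- least of order `1 / l`. Otherwise smoothing over a window of width comparable to `σ` replaces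
  -- the loss `σ` by `l ^ 2`.
  rcases le_or_gt σ (4 * l) with hσl | hσl
  · have h1 : P.eval (k : ℝ) * (3 / 4) ≤ (4 * σ + 1) * E := by
      nlinarith [mul_le_mul_of_nonneg_left hlow hPk,
        mul_le_mul_of_nonneg_left hEk (by positivity : 0 ≤ 4 * σ + 1)]
    have h2 : (4 * σ + 1) * E ≤ (16 * l + 1) * E :=
      mul_le_mul_of_nonneg_right (by linarith) hE0
    have h3 : (1 : ℝ) + d * 14 ≤ (1 + 14) ^ d := one_add_mul_le_pow (by norm_num) d
    norm_num at h3
    have h4 : (4 / 3) * (16 * l + 1) * E ≤ 12 * 15 ^ d * E := by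
      refine mul_le_mul_of_nonneg_right ?_ hE0
      rw [hlr]
      linarith
    linarith
  · have hl3 : (3 : ℝ) ≤ l := by rw [hlr]; linarith
    have hl0 : (0 : ℝ) < l := by linarith
    -- The half-width `T = l * H` satisfies `T * (T + 1) ≤ σ ^ 2`, so every weight in the window is
    -- at least half the central one. Also `T ≥ 2 / 3 * σ`, because `σ > 4 * l ≥ 12`.
    set H := ⌊(σ - 1) / l⌋₊ with hH
    have hH1 : (l : ℝ) * H ≤ σ - 1 := by
      have := Nat.floor_le (div_nonneg (by linarith : 0 ≤ σ - 1) hl0.le)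
      rw [le_div_iff₀ hl0] at this
      linarith
    have hH2 : 2 / 3 * σ ≤ l * H := by
      have := Nat.lt_floor_add_one ((σ - 1) / l)
      rw [div_lt_iff₀ hl0] at this
      linarith
    have hT : ((l * H : ℕ) : ℝ) * ((l * H : ℕ) + 1) ≤ σ ^ 2 := by
      push_cast
      nlinarith [mul_nonneg hl0.le (Nat.cast_nonneg H : (0 : ℝ) ≤ H)]
    have hT2 : ((l * H : ℕ) : ℝ) ≤ σ ^ 2 := by
      refine le_trans ?_ hT
      have h : 0 ≤ ((l * H : ℕ) : ℝ) := Nat.cast_nonneg _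
      nlinarith
    have hTk : l * H ≤ k := by
      have : ((l * H : ℕ) : ℝ) ≤ k := by
        refine hT2.trans ?_
        rw [hσ]
        nlinarith [(Nat.cast_nonneg k : (0 : ℝ) ≤ k)]
      exact_mod_cast this
    have hTn : k + l * H ≤ n := by
      have : (k : ℝ) + ((l * H : ℕ) : ℝ) ≤ n := by
        have h : k * (1 - p) ≤ n - k := by
          rw [← hk]
          have := mul_nonneg (Nat.cast_nonneg n : (0 : ℝ) ≤ n) (mul_pos hq hq).le
          nlinarith
        linarith
      exact_mod_cast this
    have hσpos : 0 < σ := by linarith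
    have hmin : ∀ j, j ≤ k + l * H → k ≤ j + l * H →
        binomialWeight p n k / 2 ≤ binomialWeight p n j := by
      intro j h1 h2
      have := (binomialWeight_bounds hp0 hp1 hk (t := l * H) (by omega : j ≤ n) h1 h2).2
      rw [← hσ] at this
      have h3 : σ ^ 2 * (binomialWeight p n k / 2) ≤ σ ^ 2 * binomialWeight p n j := by
        nlinarith [mul_le_mul_of_nonneg_left hT (hw k)]
      exact le_of_mul_le_mul_left h3 (by positivity)
    have hmain := eval_le_of_weights_lower P (l := l) (by omega) hTk hTn hpos
      (binomialWeight p n) hw hmin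
    rw [← hE] at hmain
    set w := binomialWeight p n k
    set y := P.eval (k : ℝ)
    have h5 : σ * w * y ≤ 3 * l ^ 2 * E := by
      have h6 := mul_le_mul_of_nonneg_left hmain hl0.le
      have h7 := mul_le_mul_of_nonneg_right hH2 (mul_nonneg (hw k) hPk)
      linarith
    have h8 : w * (49 / 12 * σ) ≥ 3 / 4 := by
      refine hlow.trans ?_
      refine mul_le_mul_of_nonneg_left ?_ (hw k)
      linarith
    have h9 : y ≤ 49 / 3 * l ^ 2 * E := by
      nlinarith [mul_le_mul_of_nonneg_right h8 hPk]
    refine h9.trans ?_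
    refine mul_le_mul_of_nonneg_right ?_ hE0
    rw [hlr]
    clear_value E l σ w y H
    clear * - hd
    induction d, hd using Nat.le_induction with
    | base => norm_num
    | succ d hd ih =>
      have hdr : (1 : ℝ) ≤ d := by exact_mod_cast hd
      rw [pow_succ (15 : ℝ)]
      push_cast
      nlinarith

end Univariate

/-! ### Slice averages as polynomials in the slice size. -/

section Slice

variable {α : Type*} [DecidableEq α] [Fintype α]

/-- Expectation over a uniformly random set of size `k`. -/
noncomputable def sliceExpect (α : Type*) [DecidableEq α] [Fintype α] (k : ℕ) : (Finset α → ℝ) →ₗ[ℝ] ℝ :=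
  ((Fintype.card α).choose k : ℝ)⁻¹ • ∑ A ∈ powersetCard k univ, LinearMap.proj A

theorem sliceExpect_apply (k : ℕ) (F : Finset α → ℝ) :
    sliceExpect α k F = ((Fintype.card α).choose k : ℝ)⁻¹ * ∑ A ∈ powersetCard k univ, F A := by
  simp [sliceExpect, LinearMap.sum_apply]

theorem sliceExpect_congr {k : ℕ} {F G : Finset α → ℝ} (h : ∀ A, #A = k → F A = G A) :
    sliceExpect α k F = sliceExpect α k G := by
  simp only [sliceExpect_apply]
  rw [sum_congr rfl fun A hA => h A (mem_powersetCard.1 hA).2]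

theorem sliceExpect_nonneg {k : ℕ} {F : Finset α → ℝ} (h : ∀ A, 0 ≤ F A) :
    0 ≤ sliceExpect α k F := by
  rw [sliceExpect_apply]
  exact mul_nonneg (by positivity) (sum_nonneg fun A _ => h A)

theorem sliceExpect_subsetInd {k : ℕ} (hk : k ≤ Fintype.card α) (S : Finset α) :
    sliceExpect α k (subsetInd S) =
      (k.descFactorial #S : ℝ) / ((Fintype.card α).descFactorial #S : ℝ) := by
  set n := Fintype.card α with hn
  have hSn : #S ≤ n := card_le_univ S
  have hnpos : (0 : ℝ) < n.descFactorial #S := by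
    exact_mod_cast Nat.descFactorial_pos.2 hSn
  have hcpos : (0 : ℝ) < n.choose k := by exact_mod_cast Nat.choose_pos hk
  rw [sliceExpect_apply, ← hn]
  simp only [subsetInd]
  rw [sum_boole]
  rcases le_or_gt #S k with h | h
  · rw [card_filter_powersetCard_subset S univ k (subset_univ S) h, card_univ, ← hn]
    rw [eq_div_iff hnpos.ne', inv_mul_eq_div, div_mul_eq_mul_div, div_eq_iff hcpos.ne']
    have := Nat.choose_mul (n := n) (k := k) (s := #S) h
    rw [Nat.descFactorial_eq_factorial_mul_choose, Nat.descFactorial_eq_factorial_mul_choose]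
    push_cast
    have h' : (n.choose k : ℝ) * k.choose #S = n.choose #S * (n - #S).choose (k - #S) := by
      exact_mod_cast this
    linear_combination -((#S).factorial : ℝ) * h'
  · rw [Nat.descFactorial_eq_zero_iff_lt.2 h, filter_eq_empty_iff.2]
    · simp
    · intro A hA hSA
      exact absurd (card_le_card hSA) (by rw [(mem_powersetCard.1 hA).2]; omega)

theorem biasedExpect_eq_sum_sliceExpect (p : ℝ) (F : Finset α → ℝ) :
    biasedExpect p univ F = ∑ j ∈ range (Fintype.card α + 1),
      binomialWeight p (Fintype.card α) j * sliceExpect α j F := by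
  rw [biasedExpect_apply, sum_powerset]
  refine sum_congr rfl fun j hj => ?_
  have hj' : j ≤ Fintype.card α := by rw [mem_range] at hj; omega
  have hc : ((Fintype.card α).choose j : ℝ) ≠ 0 := by
    exact_mod_cast (Nat.choose_pos hj').ne'
  rw [sliceExpect_apply, binomialWeight]
  have e : ∀ A ∈ powersetCard j (univ : Finset α),
      p ^ #A * (1 - p) ^ #(univ \ A) * F A =
        p ^ j * (1 - p) ^ (Fintype.card α - j) * F A := by
    intro A hA
    rw [card_sdiff_of_subset (subset_univ A), card_univ, (mem_powersetCard.1 hA).2]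
  rw [sum_congr rfl e, ← mul_sum]
  field_simp

-- A uniform `j`-set contains `S` with probability `j.descFactorial #S / n.descFactorial #S`, a
-- polynomial in `j` of degree `#S`. Linearity does the rest.
open Polynomial in
theorem exists_polynomial_sliceExpect {m : ℕ} {F : Finset α → ℝ}
    (hF : F ∈ lowDegree univ m) :
    ∃ P : ℝ[X], P.natDegree ≤ m ∧
      ∀ j ≤ Fintype.card α, P.eval (j : ℝ) = sliceExpect α j F := by
  induction hF using Submodule.span_induction with
  | mem F hF =>
    obtain ⟨S, -, hd, rfl⟩ := hF
    refine ⟨C (((Fintype.card α).descFactorial #S : ℝ)⁻¹) * descPochhammer ℝ #S, ?_, ?_⟩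
    · refine (natDegree_C_mul_le _ _).trans ?_
      rwa [descPochhammer_natDegree]
    · intro j hj
      rw [sliceExpect_subsetInd hj, eval_C_mul, descPochhammer_eval_eq_descFactorial,
        inv_mul_eq_div]
  | zero => exact ⟨0, by simp, by simp⟩
  | add F F' _ _ h h' =>
    obtain ⟨P, hP, hP'⟩ := h
    obtain ⟨R, hR, hR'⟩ := h'
    exact ⟨P + R, (natDegree_add_le _ _).trans (max_le hP hR), fun j hj => by
      rw [eval_add, hP' j hj, hR' j hj, map_add]⟩
  | smul r F _ h =>
    obtain ⟨P, hP, hP'⟩ := h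
    exact ⟨C r * P, (natDegree_C_mul_le _ _).trans hP, fun j hj => by
      rw [eval_C_mul, hP' j hj, map_smul, smul_eq_mul]⟩

/-- The expectation of a nonnegative low-degree function over the middle slice is controlled by
its expectation under the product distribution. -/
theorem sliceExpect_le_biasedExpect {p : ℝ} (hp0 : 0 < p) (hp1 : p < 1) {k d : ℕ}
    (hk : p * Fintype.card α = k) (hd : 1 ≤ d) {F : Finset α → ℝ}
    (hF : F ∈ lowDegree univ (4 * d)) (hpos : ∀ A, 0 ≤ F A) :
    sliceExpect α k F ≤ 12 * 15 ^ d * biasedExpect p univ F := by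
  have hkn : k ≤ Fintype.card α := by
    have : (k : ℝ) ≤ Fintype.card α := by
      rw [← hk]; nlinarith [(Nat.cast_nonneg (Fintype.card α) : (0 : ℝ) ≤ Fintype.card α)]
    exact_mod_cast this
  obtain ⟨P, hP, hPeval⟩ := exists_polynomial_sliceExpect hF
  have := eval_mean_le_binomial hp0 hp1 hk hd P hP fun j hj => by
    rw [hPeval j hj]; exact sliceExpect_nonneg hpos
  rw [hPeval k hkn] at this
  rw [biasedExpect_eq_sum_sliceExpect]
  refine this.trans_eq ?_
  congr 1
  exact sum_congr rfl fun j hj => by rw [hPeval j (by rw [mem_range] at hj; omega)]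

end Slice

theorem biasedExpect_subsetInd {α : Type*} [DecidableEq α] (p : ℝ) {s S : Finset α} (hS : S ⊆ s) :
    biasedExpect p s (subsetInd S) = p ^ #S := by
  induction s using Finset.induction generalizing S with
  | empty => simp [subset_empty.1 hS, biasedExpect_apply, subsetInd]
  | insert a s ha ih =>
    rw [biasedExpect_insert p ha]
    by_cases haS : a ∈ S
    · have h1 : S.erase a ⊆ s := subset_insert_iff.1 hS
      have h2 : (biasedExpect p s fun A => (1 - p) * subsetInd S A + p * subsetInd S (insert a A)) =
          biasedExpect p s (p • subsetInd (S.erase a)) := by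
        refine biasedExpect_congr fun A hA => ?_
        have haA : ¬ S ⊆ A := fun h => ha (hA (h haS))
        simp [subsetInd, haA, subset_insert_iff]
      rw [h2, map_smul, ih h1, smul_eq_mul, ← card_erase_add_one haS, pow_succ, mul_comm]
    · have h1 : S ⊆ s := (subset_insert_iff_of_notMem haS).1 hS
      refine Eq.trans ?_ (ih h1)
      congr 1
      ext A
      simp only [subsetInd, subset_insert_iff_of_notMem haS]
      ring

theorem sum_finset_eq_sum_card {α : Type*} [Fintype α] (f : Finset α → ℝ) :
    ∑ T, f T = ∑ i ∈ range (Fintype.card α + 1), ∑ T ∈ powersetCard i univ, f T := by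
  rw [← powerset_univ, sum_powerset, card_univ]

/-! ### Harmonic polynomials and their second moments. -/

section Harmonic

variable {α : Type*} [DecidableEq α] [Fintype α]

/-- The coefficients `a` are harmonic: all sums of `a` over the sets of a given size containing a
fixed smaller set vanish. -/
def IsHarmonic (a : Finset α → ℝ) : Prop :=
  ∀ (i : ℕ) (R : Finset α), #R < i → ∑ T ∈ powersetCard i univ with R ⊆ T, a T = 0

/-- The multilinear polynomial with coefficients `a`. -/
def setPolynomial (a : Finset α → ℝ) : Finset α → ℝ := ∑ T, a T • subsetInd T

theorem IsHarmonic.add {a b : Finset α → ℝ} (ha : IsHarmonic a) (hb : IsHarmonic b) :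
    IsHarmonic (a + b) := fun i R hR => by
  simp [sum_add_distrib, ha i R hR, hb i R hR]

theorem setPolynomial_add (a b : Finset α → ℝ) :
    setPolynomial (a + b) = setPolynomial a + setPolynomial b := by
  simp [setPolynomial, add_smul, sum_add_distrib]

/-- Moving `x` out of `S` leaves an error only on the sets `T` containing `x`, where `g` is replaced
by its forward difference. Iterating trades elements of `S` for elements of `R`, which is where
harmonicity applies. -/
theorem sum_inter_insert (a : Finset α → ℝ) (i : ℕ) (R : Finset α) (g : ℕ → ℝ) {x : α}
    {S : Finset α} (hx : x ∉ S) :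
    ∑ T ∈ powersetCard i univ with R ⊆ T, a T * g #(T ∩ insert x S) =
      ∑ T ∈ powersetCard i univ with R ⊆ T, a T * g #(T ∩ S) +
        ∑ T ∈ powersetCard i univ with insert x R ⊆ T,
          a T * (g (#(T ∩ S) + 1) - g #(T ∩ S)) := by
  rw [sum_filter, sum_filter, sum_filter, ← sum_add_distrib]
  refine sum_congr rfl fun T _ => ?_
  by_cases hxT : x ∈ T
  · rw [inter_insert_of_mem hxT, card_insert_of_notMem (by simp [hx])]
    by_cases hRT : R ⊆ T <;> simp [insert_subset_iff, hxT, hRT]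
    ring
  · rw [inter_insert_of_notMem hxT]
    simp [insert_subset_iff, hxT]

theorem IsHarmonic.sum_eq_zero {a : Finset α → ℝ} (ha : IsHarmonic a) {i : ℕ} (S : Finset α) :
    ∀ (R : Finset α) (g : ℕ → ℝ), #R + #S < i →
      ∑ T ∈ powersetCard i univ with R ⊆ T, a T * g #(T ∩ S) = 0 := by
  induction S using Finset.induction with
  | empty =>
    intro R g hR
    simp [← sum_mul, ha i R (by simpa using hR)]
  | insert x S hx ih =>
    intro R g hR
    rw [card_insert_of_notMem hx] at hR
    rw [sum_inter_insert a i R g hx, ih R g (by omega),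
      ih (insert x R) (fun r => g (r + 1) - g r) (by have := card_insert_le x R; omega), add_zero]

/-- A doubly indexed array with the recursion satisfied by the probabilities that a random set
contains `a` given elements and avoids `b` further ones, within a ground set of size `n`. -/
def IsExchangeable (n : ℕ) (γ : ℕ → ℕ → ℝ) : Prop :=
  ∀ a b, a + b < n → γ a b = γ (a + 1) b + γ a (b + 1)

/-- At the critical size `#R + #S = i`, only the term in which all of `S` has moved into `R`
survives, leaving the single set `T = R ∪ S`. By exchangeability each forward difference of `r ↦ γ
(c - r) b` is again of this form, with `c` lowered and `b` raised by one. -/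
theorem IsHarmonic.sum_eq_top {a : Finset α → ℝ} (ha : IsHarmonic a) {n : ℕ} {γ : ℕ → ℕ → ℝ}
    (hγ : IsExchangeable n γ) {i : ℕ} (S : Finset α) :
    ∀ (R : Finset α) (c b : ℕ), Disjoint R S → #R + #S = i → #S ≤ c → c + b ≤ n →
      ∑ T ∈ powersetCard i univ with R ⊆ T, a T * γ (c - #(T ∩ S)) b =
        a (R ∪ S) * γ (c - #S) (b + #S) := by
  induction S using Finset.induction with
  | empty =>
    intro R c b _ hR _ _
    have : ({T ∈ powersetCard i univ | R ⊆ T} : Finset (Finset α)) = {R} := by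
      ext T
      simp only [mem_filter, mem_powersetCard, mem_singleton, subset_univ, true_and]
      constructor
      · rintro ⟨h1, h2⟩
        exact (eq_of_subset_of_card_le h2 (by simp at hR; omega)).symm
      · rintro rfl
        exact ⟨by simpa using hR, subset_rfl⟩
    simp [this]
  | insert x S hx ih =>
    intro R c b hdis hR hc hcb
    rw [card_insert_of_notMem hx] at hR hc ⊢
    rw [disjoint_insert_right] at hdis
    have h2 := ih (insert x R) (c - 1) (b + 1)
      (disjoint_insert_left.2 ⟨hx, hdis.2⟩) (by rw [card_insert_of_notMem hdis.1]; omega)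
      (by omega) (by omega)
    rw [insert_union, ← union_insert] at h2
    rw [sum_inter_insert a i R (fun r => γ (c - r) b) hx,
      ha.sum_eq_zero (i := i) S R (fun r => γ (c - r) b) (by omega), zero_add,
      show c - (#S + 1) = c - 1 - #S by omega, show b + (#S + 1) = b + 1 + #S by omega, ← h2]
    refine sum_congr rfl fun T _ => ?_
    have hle : #(T ∩ S) ≤ #S := card_le_card inter_subset_right
    have h3 := hγ (c - 1 - #(T ∩ S)) b (by omega)
    rw [show c - 1 - #(T ∩ S) + 1 = c - #(T ∩ S) by omega] at h3
    rw [show c - (#(T ∩ S) + 1) = c - 1 - #(T ∩ S) by omega, h3]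
    ring

/-- The second moment of a harmonic polynomial under an exchangeable distribution. -/
theorem IsHarmonic.second_moment {a : Finset α → ℝ} (ha : IsHarmonic a)
    (hsupp : ∀ T, a T ≠ 0 → 2 * #T ≤ Fintype.card α) {γ : ℕ → ℕ → ℝ}
    (hγ : IsExchangeable (Fintype.card α) γ) (L : (Finset α → ℝ) →ₗ[ℝ] ℝ)
    (hL : ∀ T, L (subsetInd T) = γ #T 0) :
    L (setPolynomial a ^ 2) = ∑ T, a T ^ 2 * γ #T #T := by
  have hexp : L (setPolynomial a ^ 2) = ∑ S, ∑ T, a S * (a T * γ (#S + #T - #(T ∩ S)) 0) := by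
    rw [sq, setPolynomial, sum_mul_sum, map_sum]
    refine sum_congr rfl fun S _ => ?_
    rw [map_sum]
    refine sum_congr rfl fun T _ => ?_
    rw [smul_mul_smul_comm, subsetInd_mul, map_smul, hL, smul_eq_mul, mul_assoc,
      card_union, inter_comm S T]
  -- Layers of different sizes are orthogonal: for a fixed smaller set `S`, the summand over the
  -- larger layer depends on `T` only through `a T` and `#(T ∩ S)`.
  have hlt : ∀ i j, i < j → ∑ S ∈ powersetCard i (univ : Finset α),
      ∑ T ∈ powersetCard j (univ : Finset α),
      a S * (a T * γ (#S + #T - #(T ∩ S)) 0) = 0 := by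
    intro i j hij
    refine Finset.sum_eq_zero fun S hS => ?_
    have hSi := (mem_powersetCard.1 hS).2
    have := ha.sum_eq_zero (i := j) S ∅ (fun r => γ (#S + j - r) 0) (by simpa [hSi] using hij)
    simp only [empty_subset, filter_true] at this
    rw [← mul_sum, ← mul_zero (a S), ← this]
    congr 1
    exact sum_congr rfl fun T hT => by rw [(mem_powersetCard.1 hT).2]
  have hgt : ∀ i j, j < i → ∑ S ∈ powersetCard i (univ : Finset α),
      ∑ T ∈ powersetCard j (univ : Finset α),
      a S * (a T * γ (#S + #T - #(T ∩ S)) 0) = 0 := by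
    intro i j hij
    rw [sum_comm, ← hlt j i hij]
    refine sum_congr rfl fun S _ => sum_congr rfl fun T _ => ?_
    rw [add_comm #T #S, inter_comm S T]
    ring
  rw [hexp, sum_finset_eq_sum_card, sum_finset_eq_sum_card]
  refine sum_congr rfl fun i hi => ?_
  rw [sum_congr rfl fun S _ => sum_finset_eq_sum_card fun T => a S * (a T * γ (#S + #T - #(T ∩ S)) 0),
    sum_comm, sum_eq_single i (fun j _ hj => ?_) (fun h => absurd hi h)]
  · refine sum_congr rfl fun S hS => ?_
    have hSi := (mem_powersetCard.1 hS).2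
    by_cases haS : a S = 0
    · simp [haS]
    -- Within a layer `#(S ∪ T) = 2 * i - #(T ∩ S)`, so `c = 2 * i` and `b = 0`. The sum over `T`
    -- collapses to `a S * γ i i`.
    have := ha.sum_eq_top hγ (i := i) S ∅ (2 * i) 0 (disjoint_empty_left _) (by simpa using hSi)
      (by omega) (by have := hsupp S haS; omega)
    simp only [empty_subset, filter_true, empty_union, zero_add, hSi] at this
    rw [show 2 * i - i = i by omega] at this
    rw [← mul_sum, hSi, sq, mul_assoc, ← this]
    congr 1
    refine sum_congr rfl fun T hT => ?_
    rw [(mem_powersetCard.1 hT).2, two_mul]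
  · rcases lt_or_gt_of_ne hj with h | h
    · exact hgt i j h
    · exact hlt i j h

end Harmonic

/-! ### Harmonic representatives on a slice and comparison of second moments. -/

section Representation

variable {α : Type*} [DecidableEq α] [Fintype α]

theorem setPolynomial_apply (a : Finset α → ℝ) (A : Finset α) :
    setPolynomial a A = ∑ i ∈ range (Fintype.card α + 1), ∑ T ∈ powersetCard i univ,
      a T * subsetInd T A := by
  rw [← sum_finset_eq_sum_card, setPolynomial, Finset.sum_apply]
  rfl

theorem setPolynomial_smul (r : ℝ) (a : Finset α → ℝ) :
    setPolynomial (r • a) = r • setPolynomial a := by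
  simp [setPolynomial, mul_smul, smul_sum]

theorem setPolynomial_single (S : Finset α) : setPolynomial (Pi.single S 1) = subsetInd S := by
  rw [setPolynomial, sum_eq_single S] <;> simp +contextual

theorem setPolynomial_mem {a : Finset α → ℝ} {d : ℕ} (h : ∀ T, d < #T → a T = 0) :
    setPolynomial a ∈ lowDegree univ d := by
  refine sum_mem fun T _ => ?_
  rcases lt_or_ge d #T with hT | hT
  · rw [h T hT, zero_smul]
    exact zero_mem _
  · exact Submodule.smul_mem _ _ (subsetInd_mem (subset_univ T) hT)

theorem exists_setPolynomial {d : ℕ} {F : Finset α → ℝ} (hF : F ∈ lowDegree univ d) :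
    ∃ a : Finset α → ℝ, (∀ T, d < #T → a T = 0) ∧ F = setPolynomial a := by
  induction hF using Submodule.span_induction with
  | mem F hF =>
    obtain ⟨S, -, hd, rfl⟩ := hF
    refine ⟨Pi.single S 1, fun T hT => ?_, (setPolynomial_single S).symm⟩
    exact Pi.single_eq_of_ne (by rintro rfl; omega) _
  | zero => exact ⟨0, by simp, by simp [setPolynomial]⟩
  | add F F' _ _ h h' =>
    obtain ⟨a, ha, rfl⟩ := h
    obtain ⟨b, hb, rfl⟩ := h'
    exact ⟨a + b, fun T hT => by simp [ha T hT, hb T hT], (setPolynomial_add a b).symm⟩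
  | smul r F _ h =>
    obtain ⟨a, ha, rfl⟩ := h
    exact ⟨r • a, fun T hT => by simp [ha T hT], (setPolynomial_smul r a).symm⟩

/-- The indicator of the sets of size `d + 1` containing `R`. -/
def supersetIndicator (d : ℕ) (R : Finset α) : EuclideanSpace ℝ (Finset α) :=
  WithLp.toLp 2 fun T => if R ⊆ T ∧ #T = d + 1 then 1 else 0

/-- A `k`-set containing `R` has exactly `k - d` subsets of size `d + 1` containing `R`. These are
therefore homogeneous polynomials of degree `d + 1` that drop to degree `d` on the slice. -/
theorem setPolynomial_supersetIndicator {d : ℕ} {R : Finset α} (hR : #R = d) {k : ℕ}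
    {A : Finset α} (hA : #A = k) :
    setPolynomial (supersetIndicator d R) A = ((k : ℝ) - d) * subsetInd R A := by
  have h1 : setPolynomial (supersetIndicator d R) A =
      ∑ T, if R ⊆ T ∧ #T = d + 1 ∧ T ⊆ A then (1 : ℝ) else 0 := by
    rw [setPolynomial, Finset.sum_apply]
    refine sum_congr rfl fun T _ => ?_
    by_cases h1 : R ⊆ T <;> by_cases h2 : #T = d + 1 <;> by_cases h3 : T ⊆ A <;>
      simp [supersetIndicator, subsetInd, h1, h2, h3]
  rw [h1, sum_boole, subsetInd]
  split_ifs with h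
  · have h2 : ({T | R ⊆ T ∧ #T = d + 1 ∧ T ⊆ A} : Finset (Finset α)) =
        (powersetCard (d + 1) A).filter (R ⊆ ·) := by
      ext T
      simp only [mem_filter, mem_univ, true_and, mem_powersetCard]
      tauto
    rw [h2, card_filter_powersetCard_subset R A (d + 1) h (by omega), hR, hA]
    have : d ≤ k := by rw [← hR, ← hA]; exact card_le_card h
    simp [Nat.cast_sub this]
  · rw [filter_eq_empty_iff.2]
    · simp
    · rintro T - ⟨h1, -, h2⟩
      exact h (h1.trans h2)

/-- Smaller `R` follow by descending induction on `#R`: summing the vanishing sums for `insert x R`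
over `x ∉ R` counts every `T ⊇ R` exactly `d + 1 - #R` times, a nonzero factor. -/
theorem isHarmonic_of_sum_eq_zero {d : ℕ} {h : Finset α → ℝ} (hsupp : ∀ T, #T ≠ d + 1 → h T = 0)
    (hR : ∀ R : Finset α, #R = d → ∑ T ∈ powersetCard (d + 1) univ with R ⊆ T, h T = 0) :
    IsHarmonic h := by
  intro i R hRi
  by_cases hi : i = d + 1
  · subst hi
    obtain ⟨m, hm⟩ := Nat.exists_eq_add_of_le (Nat.lt_succ_iff.1 hRi)
    induction m generalizing R with
    | zero => exact hR R (by omega)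
    | succ m ih =>
      have hzero : ∑ x ∈ univ \ R, ∑ T ∈ powersetCard (d + 1) univ with insert x R ⊆ T, h T = 0 := by
        refine sum_eq_zero fun x hx => ?_
        have hxR : x ∉ R := (mem_sdiff.1 hx).2
        exact ih _ (by rw [card_insert_of_notMem hxR]; omega)
          (by rw [card_insert_of_notMem hxR]; omega)
      have hcount : ∑ x ∈ univ \ R, ∑ T ∈ powersetCard (d + 1) univ with insert x R ⊆ T, h T =
          ((d + 1 - #R : ℕ) : ℝ) * ∑ T ∈ powersetCard (d + 1) univ with R ⊆ T, h T := by
        simp only [sum_filter]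
        rw [sum_comm, mul_sum]
        refine sum_congr rfl fun T hT => ?_
        have hTc := (mem_powersetCard.1 hT).2
        by_cases hRT : R ⊆ T
        · have h1 : ∀ x, (if insert x R ⊆ T then h T else 0) = if x ∈ T then h T else 0 := by
            intro x
            simp [insert_subset_iff, hRT]
          simp only [h1]
          rw [← sum_filter, sum_const, nsmul_eq_mul, if_pos hRT, ← hTc,
            ← card_sdiff_of_subset hRT]
          congr 3
          ext x
          simp [and_comm]
        · simp [insert_subset_iff, hRT]
      rw [hzero] at hcount
      have hne : ((d + 1 - #R : ℕ) : ℝ) ≠ 0 := by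
        exact_mod_cast (by omega : d + 1 - #R ≠ 0)
      exact (mul_eq_zero.1 hcount.symm).resolve_left hne
  · refine sum_eq_zero fun T hT => hsupp T ?_
    rw [(mem_powersetCard.1 (mem_filter.1 hT).1).2]
    exact hi

/-- Splitting off the harmonic part of a homogeneous polynomial lowers the degree on a slice. -/
theorem exists_harmonic_add_lowDegree {d k : ℕ} {b : Finset α → ℝ}
    (hb : ∀ T, #T ≠ d + 1 → b T = 0) :
    ∃ h : Finset α → ℝ, IsHarmonic h ∧ (∀ T, #T ≠ d + 1 → h T = 0) ∧
      ∃ G ∈ lowDegree univ d, ∀ A, #A = k → setPolynomial b A = setPolynomial h A + G A := by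
  set W : Submodule ℝ (EuclideanSpace ℝ (Finset α)) :=
    Submodule.span ℝ {u | ∃ R : Finset α, #R = d ∧ u = supersetIndicator d R} with hW
  have hWprop : ∀ u ∈ W, (∀ T, #T ≠ d + 1 → u T = 0) ∧
      ∃ G ∈ lowDegree (univ : Finset α) d, ∀ A, #A = k → setPolynomial u A = G A := by
    intro u hu
    induction hu using Submodule.span_induction with
    | mem u hu =>
      obtain ⟨R, hR, rfl⟩ := hu
      refine ⟨fun T hT => by simp [supersetIndicator, hT], ((k : ℝ) - d) • subsetInd R,
        Submodule.smul_mem _ _ (subsetInd_mem (subset_univ R) hR.le), fun A hA => ?_⟩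
      exact setPolynomial_supersetIndicator hR hA
    | zero => exact ⟨by simp, 0, zero_mem _, by simp [setPolynomial]⟩
    | add u u' _ _ h h' =>
      obtain ⟨h1, G, hG, h2⟩ := h
      obtain ⟨h1', G', hG', h2'⟩ := h'
      refine ⟨fun T hT => by simp [h1 T hT, h1' T hT], G + G', add_mem hG hG', fun A hA => ?_⟩
      rw [Pi.add_apply, ← h2 A hA, ← h2' A hA, ← Pi.add_apply, ← setPolynomial_add]
      rfl
    | smul r u _ h =>
      obtain ⟨h1, G, hG, h2⟩ := h
      refine ⟨fun T hT => by simp [h1 T hT], r • G, Submodule.smul_mem _ _ hG, fun A hA => ?_⟩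
      rw [Pi.smul_apply, ← h2 A hA, ← Pi.smul_apply, ← setPolynomial_smul]
      rfl
  -- The component in `W` drops in degree on the slice. Orthogonality to the generators of `W` is
  -- precisely the vanishing condition that makes the other component harmonic.
  obtain ⟨u, hu, h, hh, hsum⟩ := W.exists_add_mem_mem_orthogonal (WithLp.toLp 2 b)
  obtain ⟨hu0, G, hG, hGA⟩ := hWprop u hu
  have hbT : ∀ T, b T = u T + h T := fun T => by
    have := congrArg (fun v : EuclideanSpace ℝ (Finset α) => v T) hsum
    simpa using this
  have hsupp : ∀ T, #T ≠ d + 1 → h T = 0 := fun T hT => by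
    have := hbT T
    rw [hb T hT, hu0 T hT] at this
    linarith
  refine ⟨h, isHarmonic_of_sum_eq_zero hsupp fun R hR => ?_, hsupp, G, hG, fun A hA => ?_⟩
  · have h0 := (Submodule.mem_orthogonal W h).1 hh (supersetIndicator d R)
      (Submodule.subset_span ⟨R, hR, rfl⟩)
    rw [PiLp.inner_apply] at h0
    rw [← h0, sum_filter, powersetCard_eq_filter, sum_filter, powerset_univ]
    refine sum_congr rfl fun T _ => ?_
    by_cases h1 : R ⊆ T <;> by_cases h2 : #T = d + 1 <;> simp [supersetIndicator, h1, h2]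
  · have : b = (u : Finset α → ℝ) + h := funext hbT
    rw [this, setPolynomial_add, Pi.add_apply, hGA A hA, add_comm]

theorem exists_harmonic {d : ℕ} (k : ℕ) :
    ∀ F ∈ lowDegree (univ : Finset α) d, ∃ a : Finset α → ℝ, IsHarmonic a ∧
      (∀ T, d < #T → a T = 0) ∧ ∀ A, #A = k → F A = setPolynomial a A := by
  induction d with
  | zero =>
    intro F hF
    obtain ⟨a, ha, rfl⟩ := exists_setPolynomial hF
    refine ⟨a, fun i R hR => sum_eq_zero fun T hT => ha T ?_, ha, fun A _ => rfl⟩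
    rw [(mem_powersetCard.1 (mem_filter.1 hT).1).2]
    omega
  | succ d ih =>
    intro F hF
    obtain ⟨c, hc, rfl⟩ := exists_setPolynomial hF
    set b : Finset α → ℝ := fun T => if #T = d + 1 then c T else 0 with hb
    obtain ⟨h, hh, hsupp, G, hG, hGA⟩ := exists_harmonic_add_lowDegree (d := d) (k := k) (b := b)
      fun T hT => by simp [hb, hT]
    have hlow : setPolynomial (c - b) ∈ lowDegree univ d := by
      refine setPolynomial_mem fun T hT => ?_
      by_cases h1 : #T = d + 1
      · simp [hb, h1]
      · simp [hb, h1, hc T (by omega)]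
    obtain ⟨a, ha, ha0, haA⟩ := ih _ (add_mem hlow hG)
    refine ⟨a + h, ha.add hh, fun T hT => ?_, fun A hA => ?_⟩
    · simp [ha0 T (by omega), hsupp T (by omega)]
    · rw [setPolynomial_add, Pi.add_apply, ← haA A hA, Pi.add_apply]
      have : setPolynomial c A = setPolynomial (c - b) A + setPolynomial b A := by
        rw [← Pi.add_apply, ← setPolynomial_add, sub_add_cancel]
      rw [this, hGA A hA]
      ring

/-- Every low-degree function on a slice is represented by a harmonic polynomial all of whose
monomials have degree at most the sizes of the two parts of the slice. -/
theorem exists_harmonic_of_slice {d k : ℕ} (hk : k ≤ Fintype.card α) {F : Finset α → ℝ}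
    (hF : F ∈ lowDegree univ d) :
    ∃ a : Finset α → ℝ, IsHarmonic a ∧
      (∀ T, a T ≠ 0 → #T ≤ d ∧ #T ≤ k ∧ #T ≤ Fintype.card α - k) ∧
      ∀ A, #A = k → F A = setPolynomial a A := by
  obtain ⟨a, ha, ha0, haA⟩ := exists_harmonic k F hF
  -- Whole layers are deleted, so harmonicity survives. The deleted layers must be shown to vanish
  -- on the slice.
  set b : Finset α → ℝ := fun T => if #T ≤ k ∧ #T ≤ Fintype.card α - k then a T else 0 with hb
  refine ⟨b, fun i R hR => ?_, fun T hT => ?_, fun A hA => ?_⟩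
  · by_cases hi : i ≤ k ∧ i ≤ Fintype.card α - k
    · rw [← ha i R hR]
      refine sum_congr rfl fun T hT => ?_
      have := (mem_powersetCard.1 (mem_filter.1 hT).1).2
      simp [hb, this, hi]
    · refine sum_eq_zero fun T hT => ?_
      have := (mem_powersetCard.1 (mem_filter.1 hT).1).2
      simp only [hb, this, if_neg hi]
  · by_cases h1 : #T ≤ k ∧ #T ≤ Fintype.card α - k
    · refine ⟨?_, h1⟩
      by_contra h2
      exact hT (by simp [hb, ha0 T (by omega)])
    · exact absurd (by simp only [hb, if_neg h1]) hT
  · rw [haA A hA, setPolynomial_apply, setPolynomial_apply]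
    refine sum_congr rfl fun i _ => ?_
    by_cases hi : i ≤ k ∧ i ≤ Fintype.card α - k
    · refine sum_congr rfl fun T hT => ?_
      have := (mem_powersetCard.1 hT).2
      simp [hb, this, hi]
    · have hr : ∑ T ∈ powersetCard i univ, b T * subsetInd T A = 0 := by
        refine sum_eq_zero fun T hT => ?_
        have := (mem_powersetCard.1 hT).2
        simp only [hb, this, if_neg hi, zero_mul]
      rw [hr]
      by_cases hik : i ≤ k
      · have hAc : #(univ \ A) = Fintype.card α - k := by
          rw [card_sdiff_of_subset (subset_univ A), card_univ, hA]
        -- Here `i > n - k`. The condition `T ⊆ A` says `#(T ∩ Aᶜ) = 0`, a function of the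
        -- intersection with a set of fewer than `i` elements, so harmonicity kills the layer.
        have := ha.sum_eq_zero (i := i) (univ \ A) ∅ (fun r => if r = 0 then 1 else 0)
          (by rw [hAc, card_empty]; omega)
        simp only [empty_subset, filter_true] at this
        rw [← this]
        refine sum_congr rfl fun T _ => ?_
        congr 1
        rw [subsetInd]
        refine if_congr ?_ rfl rfl
        simp [eq_empty_iff_forall_notMem, subset_iff]
      · refine sum_eq_zero fun T hT => ?_
        have hTi := (mem_powersetCard.1 hT).2
        have : ¬ T ⊆ A := fun h => by
          have := card_le_card h
          omega
        simp [subsetInd, this]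

theorem pow_mul_descFactorial_le {i k : ℕ} (hik : i ≤ k) (j : ℕ) :
    k ^ j * i.descFactorial j ≤ i ^ j * k.descFactorial j := by
  induction j with
  | zero => simp
  | succ j ih =>
    rw [Nat.descFactorial_succ, Nat.descFactorial_succ]
    have h : k * (i - j) ≤ i * (k - j) := by
      rw [Nat.mul_sub, Nat.mul_sub, mul_comm k i]
      exact Nat.sub_le_sub_left (Nat.mul_le_mul_right j hik) _
    calc k ^ (j + 1) * ((i - j) * i.descFactorial j)
        = (k ^ j * i.descFactorial j) * (k * (i - j)) := by ring
      _ ≤ (i ^ j * k.descFactorial j) * (i * (k - j)) := Nat.mul_le_mul ih h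
      _ = _ := by ring

/-- The ratio of `k ^ i` to `k.descFactorial i` is largest at `k = i`, where it equals `i ^ i / i! ≤
e ^ i`. This is the only source of the factor `e ^ d`. -/
theorem pow_le_exp_mul_descFactorial {i k : ℕ} (hik : i ≤ k) :
    (k : ℝ) ^ i ≤ Real.exp 1 ^ i * k.descFactorial i := by
  have h1 : (k : ℝ) ^ i * i.factorial ≤ i ^ i * k.descFactorial i := by
    have := pow_mul_descFactorial_le hik i
    rw [Nat.descFactorial_self] at this
    exact_mod_cast this
  have h2 := Real.pow_div_factorial_le_exp (i : ℝ) (Nat.cast_nonneg i) i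
  have hf : (0 : ℝ) < i.factorial := by exact_mod_cast i.factorial_pos
  rw [div_le_iff₀ hf] at h2
  rw [← Real.exp_nat_mul, mul_one]
  refine le_of_mul_le_mul_right ?_ hf
  calc (k : ℝ) ^ i * i.factorial ≤ i ^ i * k.descFactorial i := h1
    _ ≤ (Real.exp i * i.factorial) * k.descFactorial i := by gcongr
    _ = _ := by ring

theorem pow_mul_descFactorial_two_mul_le {p : ℝ} (hp0 : 0 < p) (hp : p ≤ 1 / 2) {n k : ℕ}
    (hk : p * n = k) (i : ℕ) (hik : i ≤ k) :
    (1 - p) ^ i * (n.descFactorial (2 * i) : ℝ) ≤ n ^ i * ((n - k).descFactorial i : ℝ) := by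
  have hq : 0 < 1 - p := by linarith
  have hkn : 2 * k ≤ n := by
    have : (2 : ℝ) * k ≤ n := by
      rw [← hk]; nlinarith [(Nat.cast_nonneg n : (0 : ℝ) ≤ n)]
    exact_mod_cast this
  induction i with
  | zero => simp
  | succ i ih =>
    -- Using `n - k = (1 - p) * n`, it suffices that `n * i ≤ 4 * (1 - p) * i * (n - i)`, which
    -- follows from `1 - p ≥ 1 / 2` and `2 * i ≤ n`.
    have hstep : (1 - p) * (((n - (2 * i + 1) : ℕ) : ℝ) * ((n - 2 * i : ℕ) : ℝ)) ≤
        n * ((n - k - i : ℕ) : ℝ) := by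
      rw [Nat.cast_sub (by omega), Nat.cast_sub (by omega), Nat.cast_sub (by omega),
        Nat.cast_sub (by omega), ← hk]
      push_cast
      have h1 : (2 : ℝ) * i ≤ n := by exact_mod_cast (by omega : 2 * i ≤ n)
      have h2 : (0 : ℝ) ≤ i := Nat.cast_nonneg i
      have h3 : (1 - p) * ((n - (2 * i + 1)) * (n - 2 * i)) ≤ (1 - p) * ((n - 2 * i : ℝ) * (n - 2 * i)) := by
        have : (0 : ℝ) ≤ n - 2 * i := by linarith
        gcongr
        linarith
      refine h3.trans ?_
      have h4 : 0 ≤ (1 / 2 - p) * (i * (n - i)) := by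
        refine mul_nonneg (by linarith) (mul_nonneg h2 (by linarith))
      nlinarith [mul_nonneg h2 (by linarith : (0 : ℝ) ≤ n - 2 * i)]
    rw [show 2 * (i + 1) = 2 * i + 1 + 1 by ring, Nat.descFactorial_succ, Nat.descFactorial_succ,
      Nat.descFactorial_succ]
    push_cast only [Nat.cast_mul]
    have := mul_le_mul (ih (by omega)) hstep (by positivity) (by positivity)
    calc _ = _ := by ring
      _ ≤ _ := this
      _ = _ := by ring

theorem biased_le_exp_mul_slice_of_le_half {p : ℝ} (hp0 : 0 < p) (hp : p ≤ 1 / 2) {n k : ℕ}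
    (hk : p * n = k) {i : ℕ} (hik : i ≤ k) :
    p ^ i * (1 - p) ^ i * (n.descFactorial (2 * i) : ℝ) ≤
      Real.exp 1 ^ i * (k.descFactorial i * (n - k).descFactorial i : ℝ) := by
  calc p ^ i * (1 - p) ^ i * (n.descFactorial (2 * i) : ℝ)
      ≤ p ^ i * (n ^ i * ((n - k).descFactorial i : ℝ)) := by
        rw [mul_assoc]
        exact mul_le_mul_of_nonneg_left (pow_mul_descFactorial_two_mul_le hp0 hp hk i hik)
          (by positivity)
    _ = (k : ℝ) ^ i * ((n - k).descFactorial i : ℝ) := by rw [← hk]; ring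
    _ ≤ (Real.exp 1 ^ i * k.descFactorial i) * ((n - k).descFactorial i : ℝ) :=
        mul_le_mul_of_nonneg_right (pow_le_exp_mul_descFactorial hik) (by positivity)
    _ = _ := by ring

theorem biased_le_exp_mul_slice {p : ℝ} (hp0 : 0 < p) (hp1 : p < 1) {n k : ℕ}
    (hk : p * n = k) {i : ℕ} (hik : i ≤ k) (hin : i ≤ n - k) :
    p ^ i * (1 - p) ^ i * (n.descFactorial (2 * i) : ℝ) ≤
      Real.exp 1 ^ i * (k.descFactorial i * (n - k).descFactorial i : ℝ) := by
  have hkn : k ≤ n := by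
    have : (k : ℝ) ≤ n := by rw [← hk]; nlinarith [(Nat.cast_nonneg n : (0 : ℝ) ≤ n)]
    exact_mod_cast this
  rcases le_or_gt p (1 / 2) with h | h
  · exact biased_le_exp_mul_slice_of_le_half hp0 h hk hik
  · have hk' : (1 - p) * n = ((n - k : ℕ) : ℝ) := by rw [Nat.cast_sub hkn, ← hk]; ring
    have := biased_le_exp_mul_slice_of_le_half (p := 1 - p) (by linarith) (by linarith) hk' hin
    rw [Nat.sub_sub_self hkn, sub_sub_cancel] at this
    calc _ = _ := by ring
      _ ≤ _ := this
      _ = _ := by ring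

/-- Every low-degree function on the middle slice extends to a low-degree function whose second
moment under the product distribution is controlled by the one on the slice. -/
theorem exists_extension {p : ℝ} (hp0 : 0 < p) (hp1 : p < 1) {k d : ℕ}
    (hk : p * Fintype.card α = k) {F : Finset α → ℝ} (hF : F ∈ lowDegree univ d) :
    ∃ G ∈ lowDegree (univ : Finset α) d, (∀ A, #A = k → F A = G A) ∧
      biasedExpect p univ (G ^ 2) ≤ Real.exp 1 ^ d * sliceExpect α k (F ^ 2) := by
  set n := Fintype.card α with hn
  have hkn : k ≤ n := by
    have : (k : ℝ) ≤ n := by rw [← hk]; nlinarith [(Nat.cast_nonneg n : (0 : ℝ) ≤ n)]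
    exact_mod_cast this
  obtain ⟨a, ha, hsupp, haA⟩ := exists_harmonic_of_slice hkn hF
  refine ⟨setPolynomial a, setPolynomial_mem fun T hT => ?_, haA, ?_⟩
  · by_contra h
    have := (hsupp T h).1
    omega
  have hsupp2 : ∀ T, a T ≠ 0 → 2 * #T ≤ Fintype.card α := fun T hT => by
    have := hsupp T hT
    omega
  have hU := ha.second_moment hsupp2 (γ := fun a b => p ^ a * (1 - p) ^ b)
    (fun a b _ => by simp only [pow_succ]; ring) (biasedExpect p univ)
    fun T => by simp [biasedExpect_subsetInd p (subset_univ T)]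
  have hD := ha.second_moment hsupp2
    -- This is the probability that a uniform `k`-set contains `a` given elements and avoids `b`
    -- others. Its product-measure analogue above is `p ^ a * (1 - p) ^ b`.
    (γ := fun a b => (k.descFactorial a * (n - k).descFactorial b : ℝ) / n.descFactorial (a + b))
    (fun a b hab => by
      beta_reduce
      rw [show a + 1 + b = a + b + 1 by ring, show a + (b + 1) = a + b + 1 by ring, ← add_div,
        Nat.descFactorial_succ, Nat.descFactorial_succ, Nat.descFactorial_succ]
      have h1 : (0 : ℝ) < n.descFactorial (a + b) := by
        exact_mod_cast Nat.descFactorial_pos.2 hab.le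
      have h2 : (0 : ℝ) < ((n - (a + b) : ℕ) : ℝ) := by exact_mod_cast (by omega)
      push_cast only [Nat.cast_mul]
      rw [div_eq_div_iff h1.ne' (by positivity)]
      rcases lt_or_ge k a with h3 | h3
      · simp [Nat.descFactorial_eq_zero_iff_lt.2 h3]
      rcases lt_or_ge (n - k) b with h4 | h4
      · simp [Nat.descFactorial_eq_zero_iff_lt.2 h4]
      have h5 : ((n - (a + b) : ℕ) : ℝ) = ((k - a : ℕ) : ℝ) + ((n - k - b : ℕ) : ℝ) := by
        exact_mod_cast (by omega)
      rw [h5]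
      ring)
    (sliceExpect α k) fun T => by simp [sliceExpect_subsetInd hkn, hn]
  have hFa : sliceExpect α k (F ^ 2) = sliceExpect α k (setPolynomial a ^ 2) :=
    sliceExpect_congr fun A hA => by rw [Pi.pow_apply, Pi.pow_apply, haA A hA]
  rw [hFa, hU, hD, mul_sum]
  refine sum_le_sum fun T _ => ?_
  by_cases haT : a T = 0
  · simp [haT]
  obtain ⟨h1, h2, h3⟩ := hsupp T haT
  have hpos : (0 : ℝ) < n.descFactorial (#T + #T) := by
    exact_mod_cast Nat.descFactorial_pos.2 (by omega)
  have hmain := biased_le_exp_mul_slice hp0 hp1 hk h2 h3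
  rw [two_mul] at hmain
  have hexp : Real.exp 1 ^ #T ≤ Real.exp 1 ^ d :=
    pow_le_pow_right₀ (Real.one_le_exp zero_le_one) h1
  rw [mul_left_comm (Real.exp 1 ^ d)]
  refine mul_le_mul_of_nonneg_left ?_ (sq_nonneg _)
  rw [mul_div_assoc', le_div_iff₀ hpos]
  refine hmain.trans ?_
  gcongr

end Representation

/-! ### From assignments and multivariate polynomials to functions of sets. -/

section Transfer

/-- Assignments correspond to the sets of coordinates at which they equal `-1`. -/
def assignmentEquiv (n : ℕ) : Assignment n ≃ Finset (Fin n) where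
  toFun x := {i | x i ≠ 1}
  invFun A i := if i ∈ A then -1 else 1
  left_inv x := by
    ext i
    rcases Int.units_eq_one_or (x i) with h | h <;> simp [h]
  right_inv A := by
    ext i
    by_cases h : i ∈ A <;> simp [h]

theorem assignmentEquiv_symm_apply {n : ℕ} (A : Finset (Fin n)) (i : Fin n) :
    (assignmentEquiv n).symm A i = if i ∈ A then -1 else 1 := rfl

theorem assignmentEquiv_symm_eq_one_iff {n : ℕ} (A : Finset (Fin n)) (i : Fin n) :
    (assignmentEquiv n).symm A i = 1 ↔ i ∉ A := by
  rw [assignmentEquiv_symm_apply]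
  by_cases h : i ∈ A <;> simp [h]

theorem coord_assignmentEquiv_symm {n : ℕ} (A : Finset (Fin n)) (i : Fin n) :
    coord ((assignmentEquiv n).symm A) i = 1 + (-2) * subsetInd {i} A := by
  rw [coord, assignmentEquiv_symm_apply]
  by_cases h : i ∈ A <;> simp [subsetInd, h]
  norm_num

theorem biasedChar_assignmentEquiv_symm (p : ℝ) {n : ℕ} (A : Finset (Fin n)) (i : Fin n) :
    biasedChar p ((assignmentEquiv n).symm A) i = Real.sqrt (p / (1 - p)) +
      (-Real.sqrt ((1 - p) / p) - Real.sqrt (p / (1 - p))) * subsetInd {i} A := by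
  rw [biasedChar]
  simp only [assignmentEquiv_symm_eq_one_iff]
  by_cases h : i ∈ A <;> simp [subsetInd, h]

theorem assignmentEquiv_symm_mem_slice {p : ℝ} {n k : ℕ} (hk : p * n = k) (A : Finset (Fin n)) :
    (assignmentEquiv n).symm A ∈ slice p n ↔ #A = k := by
  have h : ∑ i, coord ((assignmentEquiv n).symm A) i = n - 2 * #A := by
    simp only [coord_assignmentEquiv_symm, sum_add_distrib, ← mul_sum, subsetInd,
      singleton_subset_iff]
    rw [sum_boole]
    simp
    ring
  rw [slice, mem_filter, h]
  simp only [mem_univ, true_and]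
  rw [← Nat.cast_inj (R := ℝ), ← hk]
  constructor <;> intro h <;> linarith

theorem sum_slice {p : ℝ} {n k : ℕ} (hk : p * n = k) (F : Assignment n → ℝ) :
    ∑ x ∈ slice p n, F x = ∑ A ∈ powersetCard k univ, F ((assignmentEquiv n).symm A) := by
  refine (sum_equiv (assignmentEquiv n).symm (fun A => ?_) fun A _ => rfl).symm
  rw [assignmentEquiv_symm_mem_slice hk, mem_powersetCard]
  simp

theorem expectD_eq {p : ℝ} {n k : ℕ} (hk : p * n = k) (F : Assignment n → ℝ) :
    expectD p F = sliceExpect (Fin n) k (F ∘ (assignmentEquiv n).symm) := by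
  have hcard : ((#(slice p n) : ℕ) : ℝ) = n.choose k := by
    have := sum_slice hk fun _ => 1
    simpa using this
  rw [expectD, expect_eq_sum_div_card, hcard, sum_slice hk, sliceExpect_apply, Fintype.card_fin,
    div_eq_inv_mul]
  rfl

theorem expectU_eq (p : ℝ) {n : ℕ} (F : Assignment n → ℝ) :
    expectU p F = biasedExpect p univ (F ∘ (assignmentEquiv n).symm) := by
  rw [expectU, biasedExpect_apply, powerset_univ]
  refine (Fintype.sum_equiv (assignmentEquiv n).symm _ _ fun A => ?_).symm
  rw [Function.comp_apply]
  congr 1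
  simp only [assignmentEquiv_symm_eq_one_iff]
  rw [prod_ite, prod_const, prod_const, mul_comm]
  congr 3
  · ext i; simp
  · ext i; simp

theorem prod_mem_lowDegree {α ι : Type*} [DecidableEq α] {s : Finset α} {t : Finset ι}
    {F : ι → Finset α → ℝ} {m : ι → ℕ} (h : ∀ i ∈ t, F i ∈ lowDegree s (m i)) :
    ∏ i ∈ t, F i ∈ lowDegree s (∑ i ∈ t, m i) := by
  classical
  induction t using Finset.induction with
  | empty => simpa using one_mem_lowDegree s 0
  | insert a t ha ih =>
    rw [prod_insert ha, sum_insert ha]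
    exact mul_mem_lowDegree (h a (mem_insert_self a t))
      (ih fun i hi => h i (mem_insert_of_mem hi))

/-- The substitution is an arbitrary affine function of the indicators, so the characters `φ` and
the entries `x` are covered at once. -/
theorem eval_mem_lowDegree {n d : ℕ} (f : MvPolynomial (Fin n) ℝ) (hdeg : f.totalDegree ≤ d)
    {g : Finset (Fin n) → Fin n → ℝ} {b c : ℝ} (hg : ∀ A i, g A i = b + c * subsetInd {i} A) :
    (fun A => MvPolynomial.eval (g A) f) ∈ lowDegree univ d := by
  have hlin : ∀ i, (fun A => g A i) ∈ lowDegree (univ : Finset (Fin n)) 1 := by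
    intro i
    have : (fun A => g A i) = b • (1 : Finset (Fin n) → ℝ) + c • subsetInd {i} := by
      ext A
      simp [hg]
    rw [this]
    exact add_mem (Submodule.smul_mem _ _ (one_mem_lowDegree _ _))
      (Submodule.smul_mem _ _ (subsetInd_mem (subset_univ _) (by simp)))
  have : (fun A => MvPolynomial.eval (g A) f) =
      ∑ m ∈ f.support, f.coeff m • ∏ i, (fun A => g A i) ^ m i := by
    ext A
    simp [MvPolynomial.eval_eq', Finset.sum_apply, Finset.prod_apply]
  rw [this]
  refine sum_mem fun m hm => Submodule.smul_mem _ _ ?_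
  refine lowDegree_mono univ ?_ (prod_mem_lowDegree fun i _ => pow_mem_lowDegree (hlin i) (m i))
  have h := (MvPolynomial.le_totalDegree hm).trans hdeg
  rw [Finsupp.sum_fintype _ _ fun _ => rfl] at h
  simpa using h

end Transfer

/-! ### Fourth-moment bounds on the slice and numerical constants. -/

section Hypercontractivity

variable {α : Type*} [DecidableEq α] [Fintype α]

theorem sliceExpect_fourth_moment_le_biasedExpect {p : ℝ} (hp0 : 0 < p) (hp1 : p < 1) {k d : ℕ}
    (hk : p * Fintype.card α = k) (hd : 1 ≤ d) {F : Finset α → ℝ} (hF : F ∈ lowDegree univ d) :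
    sliceExpect α k (F ^ 4) ≤ 12 * 15 ^ d *
      (((1 - p * (1 - p)) / (p * (1 - p))) ^ d * biasedExpect p univ (F ^ 2)) ^ 2 := by
  refine (sliceExpect_le_biasedExpect hp0 hp1 hk hd (pow_mem_lowDegree hF 4) fun A => ?_).trans ?_
  · rw [Pi.pow_apply]
    positivity
  · exact mul_le_mul_of_nonneg_left (biasedExpect_fourth_moment_le hp0 hp1 univ d F hF)
      (by positivity)

theorem sliceExpect_fourth_moment_le {p : ℝ} (hp0 : 0 < p) (hp1 : p < 1) {k d : ℕ}
    (hk : p * Fintype.card α = k) (hd : 1 ≤ d) {F : Finset α → ℝ} (hF : F ∈ lowDegree univ d) :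
    sliceExpect α k (F ^ 4) ≤ 12 * 15 ^ d *
      (((1 - p * (1 - p)) / (p * (1 - p))) ^ d *
        (Real.exp 1 ^ d * sliceExpect α k (F ^ 2))) ^ 2 := by
  obtain ⟨G, hG, hFG, hle⟩ := exists_extension hp0 hp1 hk hF
  have hq := sub_pos.2 hp1
  have hv : p * (1 - p) ≤ 1 := by nlinarith
  have h4 : sliceExpect α k (F ^ 4) = sliceExpect α k (G ^ 4) :=
    sliceExpect_congr fun A hA => by rw [Pi.pow_apply, Pi.pow_apply, hFG A hA]
  rw [h4]
  refine (sliceExpect_fourth_moment_le_biasedExpect hp0 hp1 hk hd hG).trans ?_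
  have h0 : 0 ≤ biasedExpect p univ (G ^ 2) :=
    biasedExpect_nonneg hp0.le hp1.le fun A => sq_nonneg (G A)
  have hκ : 0 ≤ (1 - p * (1 - p)) / (p * (1 - p)) :=
    div_nonneg (by linarith) (by positivity)
  gcongr

/-- Here `15` comes from the passage to the slice, `37 / 5` is an upper bound for `e ^ 2`, and the
squared ratio is Bonami's constant. Since `15 * (37 / 5) = 111 ≤ (53 / 5) ^ 2`, it is enough to
compare square roots. That comparison is nearly tight at `p = 1 / 2`, where it reads `31.8 ≤ 32`. -/
theorem hypercontractive_constant_le {p : ℝ} (hp0 : 0 < p) (hp1 : p < 1) :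
    15 * (37 / 5) * ((1 - p * (1 - p)) / (p * (1 - p))) ^ 2 ≤
      256 * (((1 - p) / p) ^ 2 + (p / (1 - p)) ^ 2) ^ 2 := by
  have hq := sub_pos.2 hp1
  have hv : 0 < p * (1 - p) := by positivity
  have hv4 : p * (1 - p) ≤ 1 / 4 := by nlinarith [sq_nonneg (2 * p - 1)]
  have e : ((1 - p) / p) ^ 2 + (p / (1 - p)) ^ 2 =
      (1 - 4 * (p * (1 - p)) + 2 * (p * (1 - p)) ^ 2) / (p * (1 - p)) ^ 2 := by
    field_simp
    ring
  rw [e]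
  set v := p * (1 - p)
  have h : 53 / 5 * ((1 - v) / v) ≤ 16 * ((1 - 4 * v + 2 * v ^ 2) / v ^ 2) := by
    have h1 : 16 * ((1 - 4 * v + 2 * v ^ 2) / v ^ 2) - 53 / 5 * ((1 - v) / v) =
        (16 * (1 - 4 * v + 2 * v ^ 2) - 53 / 5 * (1 - v) * v) / v ^ 2 := by
      field_simp
    rw [← sub_nonneg, h1]
    exact div_nonneg (by nlinarith) (by positivity)
  have h0 : 0 ≤ (1 - v) / v := div_nonneg (by linarith) hv.le
  have h2 := pow_le_pow_left₀ (by positivity) h 2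
  nlinarith [sq_nonneg ((1 - v) / v)]

theorem biased_constant_le {d : ℕ} (hd : 1 ≤ d) {κ C N : ℝ} (hC : 15 * (37 / 5) * κ ^ 2 ≤ C) :
    12 * 15 ^ d * (κ ^ d * N) ^ 2 ≤ 3 * (d : ℝ) ^ (3 / 2 : ℝ) * C ^ d * N ^ 2 := by
  have h1 : (1 : ℝ) ≤ (d : ℝ) ^ (3 / 2 : ℝ) :=
    Real.one_le_rpow (by exact_mod_cast hd) (by norm_num)
  -- No extension is needed for the first claim, so the room kept for `e ^ 2` instead turns the
  -- factor `12` into `3`.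
  have h2 : (4 : ℝ) ≤ (37 / 5) ^ d :=
    (by norm_num : (4 : ℝ) ≤ 37 / 5).trans (le_self_pow₀ (by norm_num) (by omega))
  calc 12 * 15 ^ d * (κ ^ d * N) ^ 2 = 3 * 1 * (4 * (15 * κ ^ 2) ^ d) * N ^ 2 := by
        rw [mul_pow 15, ← pow_mul]; ring
    _ ≤ 3 * (d : ℝ) ^ (3 / 2 : ℝ) * ((37 / 5) ^ d * (15 * κ ^ 2) ^ d) * N ^ 2 := by gcongr
    _ = 3 * (d : ℝ) ^ (3 / 2 : ℝ) * (15 * (37 / 5) * κ ^ 2) ^ d * N ^ 2 := by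
        rw [← mul_pow]; ring_nf
    _ ≤ _ := by gcongr

theorem slice_constant_le {d : ℕ} (hd : 1 ≤ d) {κ C M : ℝ} (hC : 15 * (37 / 5) * κ ^ 2 ≤ C) :
    12 * 15 ^ d * (κ ^ d * (Real.exp 1 ^ d * M)) ^ 2 ≤
      12 * (d : ℝ) ^ (3 / 2 : ℝ) * C ^ d * M ^ 2 := by
  have h1 : (1 : ℝ) ≤ (d : ℝ) ^ (3 / 2 : ℝ) :=
    Real.one_le_rpow (by exact_mod_cast hd) (by norm_num)
  have h2 : Real.exp 1 ^ 2 ≤ 37 / 5 := by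
    have := pow_le_pow_left₀ (Real.exp_pos 1).le Real.exp_one_lt_d9.le 2
    norm_num at this ⊢
    linarith
  calc 12 * 15 ^ d * (κ ^ d * (Real.exp 1 ^ d * M)) ^ 2
      = 12 * 1 * (15 * Real.exp 1 ^ 2 * κ ^ 2) ^ d * M ^ 2 := by
        rw [mul_pow _ (κ ^ 2), mul_pow 15, ← pow_mul, ← pow_mul]; ring
    _ ≤ 12 * (d : ℝ) ^ (3 / 2 : ℝ) * (15 * (37 / 5) * κ ^ 2) ^ d * M ^ 2 := by gcongr
    _ ≤ _ := by gcongr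

end Hypercontractivity

end GlobalCardinality

theorem mainTheorem3 (n d : ℕ) (hd : 1 ≤ d) (p : ℝ) (hp0 : 0 < p) (hp1 : p < 1)
    (hpn : ∃ k : ℕ, p * (n : ℝ) = (k : ℝ))
    (f : MvPolynomial (Fin n) ℝ) (hf : GlobalCardinality.IsMultilinear f)
    (hdeg : f.totalDegree ≤ d) :
    -- `f` as a polynomial in the characters `φ`, against the `L₂` norm under `U_p`
    (GlobalCardinality.expectD p
        (fun x => MvPolynomial.eval (GlobalCardinality.biasedChar p x) f ^ 4) ≤
      3 * (d : ℝ) ^ (3 / 2 : ℝ) *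
        (256 * (((1 - p) / p) ^ 2 + (p / (1 - p)) ^ 2) ^ 2) ^ d *
        GlobalCardinality.normU p
          (fun x => MvPolynomial.eval (GlobalCardinality.biasedChar p x) f) ^ 4) ∧
    -- `f` as a polynomial in the characters `φ`, against the second moment under `D_p`
    (GlobalCardinality.expectD p
        (fun x => MvPolynomial.eval (GlobalCardinality.biasedChar p x) f ^ 4) ≤
      12 * (d : ℝ) ^ (3 / 2 : ℝ) *
        (256 * (((1 - p) / p) ^ 2 + (p / (1 - p)) ^ 2) ^ 2) ^ d *
        GlobalCardinality.expectD p
          (fun x => MvPolynomial.eval (GlobalCardinality.biasedChar p x) f ^ 2) ^ 2) ∧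
    -- `f` as a polynomial in the entries `x`, against the second moment under `D_p`
    (GlobalCardinality.expectD p
        (fun x => MvPolynomial.eval (GlobalCardinality.coord x) f ^ 4) ≤
      12 * (d : ℝ) ^ (3 / 2 : ℝ) *
        (256 * (((1 - p) / p) ^ 2 + (p / (1 - p)) ^ 2) ^ 2) ^ d *
        GlobalCardinality.expectD p
          (fun x => MvPolynomial.eval (GlobalCardinality.coord x) f ^ 2) ^ 2) := by
  open GlobalCardinality in
  obtain ⟨k, hk⟩ := hpn
  have hC := hypercontractive_constant_le hp0 hp1
  have hk' : p * (Fintype.card (Fin n) : ℝ) = k := by rwa [Fintype.card_fin]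
  have hφ := eval_mem_lowDegree f hdeg (biasedChar_assignmentEquiv_symm p)
  have hx := eval_mem_lowDegree f hdeg coord_assignmentEquiv_symm
  refine ⟨?_, ?_, ?_⟩
  · have hnorm : normU p (fun x => MvPolynomial.eval (biasedChar p x) f) ^ 4 =
        expectU p (fun x => MvPolynomial.eval (biasedChar p x) f ^ 2) ^ 2 := by
      have h0 : 0 ≤ expectU p fun x => MvPolynomial.eval (biasedChar p x) f ^ 2 := by
        rw [expectU_eq]
        exact biasedExpect_nonneg hp0.le hp1.le fun A => sq_nonneg _
      rw [normU, show 4 = 2 * 2 from rfl, pow_mul, Real.sq_sqrt h0]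
    rw [hnorm, expectD_eq hk, expectU_eq]
    exact (sliceExpect_fourth_moment_le_biasedExpect hp0 hp1 hk' hd hφ).trans
      (biased_constant_le hd hC)
  · rw [expectD_eq hk, expectD_eq hk]
    exact (sliceExpect_fourth_moment_le hp0 hp1 hk' hd hφ).trans (slice_constant_le hd hC)
  · rw [expectD_eq hk, expectD_eq hk]
    exact (sliceExpect_fourth_moment_le hp0 hp1 hk' hd hx).trans (slice_constant_le hd hC)
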